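/- Let $p$ be a prime and let $R$ be a complete discrete valuation ring whose maximal ideal is generated by $p$, equipped with a ring endomorphism $\phi$ lifting the $p$-power Frobenius of $k:=R/pR$ (for instance $R=\widehat{\mathbb{Z}_p^{ur}}$ with its unique such $\phi$). Extend $\phi$ to the ring endomorphism of $R\{x\}=R[x,x',x'',\dots]$ with $\phi(x^{(i)})=(x^{(i)})^p+p\,x^{(i+1)}$ (where $x^{(0)}=x$), and let $\delta G=(\phi(G)-G^p)/p$ for $G\in R\{x\}$; in particular $\delta^i x=x^{(i)}$. For a closed subscheme $X=\mathrm{Spec}\,R[x]/I$ of the affine line put $$\mathcal{O}^n(X)=\frac{R[x,x',\dots,x^{(n)}]\,\hat{}}{(f,\delta f,\dots,\delta^n f\ ;\ f\in I)},$$ where $\hat{}$ denotes $p$-adic completion, and $\overline{\mathcal{O}^n(X)}=\mathcal{O}^n(X)/p\,\mathcal{O}^n(X)$; the inclusions of polynomial rings make these an inductive system. Let $\mathcal{F}$ be a one-dimensional formal group law over $R$, in the variable $x$, whose reduction mod $p$ has finite height $h$ (i.e. $[p]_{\mathcal F}(x)$ is nonzero mod $p$, and $h$ is the largest integer such that $[p]_{\mathcal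 F}(x)$ mod $p$ is a power series in $x^{p^h}$). Assume that $p$ is odd, or that $p=2$ and $h\ge 2$. Let $\nu\ge 0$ and let $\mathcal{F}[p^\nu]=\mathrm{Spec}\,R[[x]]/([p^\nu]_{\mathcal F}(x))$ be the kernel of multiplication by $p^\nu$, viewed as a finite flat group scheme over $R$ and as a closed subscheme of the affine line through the coordinate $x$. Then there is an isomorphism of $k$-algebras $$\varinjlim_n \overline{\mathcal{O}^n(\mathcal{F}[p^\nu])}\;\simeq\;\frac{k[x,x',x'',\dots]}{(x^{p^\nu},(x')^{p^\nu},(x'')^{p^\nu},\dots)}$$ sending the class of $\delta^i x$ to the class of $x^{(i)}$ for every $i\ge 0$. -/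

import Mathlib

noncomputable section

namespace ArithmeticJet

/-- A complete local `p`-ring: a discrete valuation ring whose maximal ideal is generated by `p`
and which is `p`-adically complete (and separated). -/
class IsCompleteLocalPRing (p : ℕ) (R : Type*) [CommRing R] [IsDomain R] : Prop
    extends IsDiscreteValuationRing R where
  maximalIdeal_eq : IsLocalRing.maximalIdeal R = Ideal.span {(p : R)}
  isAdicComplete : IsAdicComplete (Ideal.span {(p : R)}) R

/-- A ring endomorphism of `R` lifting the `p`-power Frobenius of `R / pR`. -/
structure FrobeniusLift (p : ℕ) (R : Type*) [CommRing R] where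
  toRingHom : R →+* R
  dvd_sub_pow : ∀ a : R, (p : R) ∣ toRingHom a - a ^ p

section Prolongation

variable {p : ℕ} {R : Type*} [CommRing R] (φ : FrobeniusLift p R)

/-- The ring `R{x} = R[x, x', x'', …]`; the variable `X i` stands for `x^{(i)}`. -/
abbrev DiffPoly (R : Type*) [CommRing R] : Type _ := MvPolynomial ℕ R

/-- The ring `R[x, x', …, x^{(n)}]`. -/
abbrev JetPoly (R : Type*) [CommRing R] (n : ℕ) : Type _ := MvPolynomial (Fin (n + 1)) R

/-- The endomorphism of `R{x}` that extends `φ` and sends `x^{(i)}` to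
`(x^{(i)})^p + p x^{(i+1)}`. -/
def frob : DiffPoly R →+* DiffPoly R :=
  MvPolynomial.eval₂Hom (MvPolynomial.C.comp φ.toRingHom)
    (fun i => MvPolynomial.X i ^ p + (p : DiffPoly R) * MvPolynomial.X (i + 1))

theorem dvd_frob_sub_pow [hp : Fact p.Prime] (G : DiffPoly R) :
    (p : DiffPoly R) ∣ frob φ G - G ^ p := by
  induction G using MvPolynomial.induction_on with
  | C a =>
    obtain ⟨b, hb⟩ := φ.dvd_sub_pow a
    refine ⟨MvPolynomial.C b, ?_⟩
    simp only [frob, MvPolynomial.coe_eval₂Hom, MvPolynomial.eval₂_C, RingHom.comp_apply]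
    rw [← map_pow, ← map_sub, hb, map_mul, map_natCast]
  | add f g hf hg =>
    obtain ⟨r, hr⟩ := exists_add_pow_prime_eq hp.out f g
    rw [map_add, hr]
    have h : frob φ f + frob φ g - (f ^ p + g ^ p + p * f * g * r)
        = (frob φ f - f ^ p) + (frob φ g - g ^ p) - p * (f * g * r) := by ring
    rw [h]
    exact dvd_sub (dvd_add hf hg) (dvd_mul_right _ _)
  | mul_X f i hf =>
    have h : frob φ (MvPolynomial.X i)
        = MvPolynomial.X i ^ p + (p : DiffPoly R) * MvPolynomial.X (i + 1) := by
      simp [frob]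
    rw [map_mul, mul_pow, h]
    have h2 : frob φ f * (MvPolynomial.X i ^ p + (p : DiffPoly R) * MvPolynomial.X (i + 1))
        - f ^ p * MvPolynomial.X i ^ p = (frob φ f - f ^ p) * MvPolynomial.X i ^ p
          + (p : DiffPoly R) * (frob φ f * MvPolynomial.X (i + 1)) := by ring
    rw [h2]
    exact dvd_add (hf.mul_right _) (dvd_mul_right _ _)

/-- The `p`-derivation `δ G = (φ(G) - G^p) / p` of `R{x}`. -/
def delta [Fact p.Prime] (G : DiffPoly R) : DiffPoly R :=
  Classical.choose (dvd_frob_sub_pow φ G)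

theorem p_mul_delta [Fact p.Prime] (G : DiffPoly R) :
    (p : DiffPoly R) * delta φ G = frob φ G - G ^ p :=
  (Classical.choose_spec (dvd_frob_sub_pow φ G)).symm

/-- The class of `R{x}` in `R[x, …, x^{(n)}]`: the identity on `R[x, …, x^{(n)}] ⊆ R{x}`, while the
variables of order greater than `n` go to `0`. It is only ever applied to elements of
`R[x, …, x^{(n)}]`, see `rename_truncate_delta_iterate`. -/
def truncate (n : ℕ) : DiffPoly R →ₐ[R] JetPoly R n :=
  MvPolynomial.killCompl (f := fun j : Fin (n + 1) => (j : ℕ)) Fin.val_injective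

/-- The inclusion of `R[x, …, x^{(n)}]` in `R{x}`. -/
def incl (n : ℕ) : JetPoly R n →ₐ[R] DiffPoly R :=
  MvPolynomial.rename (fun j : Fin (n + 1) => (j : ℕ))

theorem truncate_incl (n : ℕ) (G : JetPoly R n) : truncate n (incl n G) = G :=
  MvPolynomial.killCompl_rename_app Fin.val_injective G

/-- A polynomial in `x`, as an element of `R{x}`. -/
def ofPoly : Polynomial R →ₐ[R] DiffPoly R := Polynomial.aeval (MvPolynomial.X 0)

end Prolongation

section JetRing

variable {p : ℕ} {R : Type*} [CommRing R]

theorem frob_mem_range (φ : FrobeniusLift p R) (n : ℕ) (G : JetPoly R n) :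
    frob φ (incl n G) ∈ (incl (R := R) (n + 1)).range := by
  induction G using MvPolynomial.induction_on with
  | C a => exact ⟨MvPolynomial.C (φ.toRingHom a), by simp [incl, frob]⟩
  | add f g hf hg => rw [map_add, map_add]; exact add_mem hf hg
  | mul_X f i hf =>
    rw [map_mul, map_mul]
    refine mul_mem hf ?_
    refine ⟨MvPolynomial.X i.castSucc ^ p + (p : JetPoly R (n + 1)) * MvPolynomial.X i.succ, ?_⟩
    simp [incl, frob]

theorem incl_mem_range {n m : ℕ} (h : n ≤ m) (G : JetPoly R n) :
    incl n G ∈ (incl (R := R) m).range :=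
  ⟨MvPolynomial.rename (Fin.castLE (Nat.succ_le_succ h)) G, by
    simp only [incl, AlgHom.toRingHom_eq_coe, RingHom.coe_coe]
    rw [MvPolynomial.rename_rename]; rfl⟩

variable [IsDomain R]

theorem natCast_ne_zero [IsCompleteLocalPRing p R] : (p : R) ≠ 0 := by
  intro h
  have h1 := IsCompleteLocalPRing.maximalIdeal_eq (p := p) (R := R)
  rw [h, Ideal.span_singleton_eq_bot.mpr rfl] at h1
  exact IsDiscreteValuationRing.not_a_field R h1

theorem natCast_diffPoly_ne_zero [IsCompleteLocalPRing p R] : (p : DiffPoly R) ≠ 0 := by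
  intro h
  apply natCast_ne_zero (p := p) (R := R)
  apply MvPolynomial.C_injective ℕ R
  rw [map_natCast, h, map_zero]

variable [Fact p.Prime] [IsCompleteLocalPRing p R] (φ : FrobeniusLift p R)

theorem delta_X (i : ℕ) :
    delta φ (MvPolynomial.X i : DiffPoly R) = MvPolynomial.X (i + 1) := by
  apply mul_left_cancel₀ (natCast_diffPoly_ne_zero (p := p) (R := R))
  rw [p_mul_delta]
  simp [frob]

theorem delta_iterate_X (i : ℕ) :
    (delta φ)^[i] (MvPolynomial.X 0 : DiffPoly R) = MvPolynomial.X i := by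
  induction i with
  | zero => rfl
  | succ i ih => rw [Function.iterate_succ_apply', ih, delta_X]

theorem delta_mem_range {n : ℕ} {G : DiffPoly R} (hG : G ∈ (incl (R := R) n).range) :
    delta φ G ∈ (incl (R := R) (n + 1)).range := by
  obtain ⟨G, rfl⟩ := hG
  obtain ⟨H, hH⟩ := sub_mem (frob_mem_range φ n G)
    (pow_mem (incl_mem_range (Nat.le_succ n) G) p)
  refine ⟨truncate (n + 1) (delta φ (incl n G)), ?_⟩
  apply mul_left_cancel₀ (natCast_diffPoly_ne_zero (p := p) (R := R))
  have h1 : (p : DiffPoly R) * delta φ (incl n G) = incl (n + 1) H := by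
    rw [p_mul_delta]; exact hH.symm
  have h2 := congrArg (fun T => incl (n + 1) (truncate (n + 1) T)) h1
  simp only [truncate_incl, map_mul, map_natCast] at h2
  exact h2.trans h1.symm

theorem delta_iterate_mem_range (f : Polynomial R) (i : ℕ) :
    (delta φ)^[i] (ofPoly f) ∈ (incl (R := R) i).range := by
  induction i with
  | zero =>
    induction f using Polynomial.induction_on' with
    | add f g hf hg =>
      simp only [Function.iterate_zero, id] at hf hg ⊢
      rw [map_add]; exact add_mem hf hg
    | monomial k a =>
      exact ⟨MvPolynomial.C a * MvPolynomial.X 0 ^ k, by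
        simp [incl, ofPoly, Polynomial.aeval_monomial, MvPolynomial.algebraMap_eq]⟩
  | succ i ih =>
    rw [Function.iterate_succ_apply']
    exact delta_mem_range φ ih

/-- `δ^i f` lies in `R[x, …, x^{(n)}]` for `f ∈ R[x]` and `i ≤ n`. -/
theorem rename_truncate_delta_iterate (f : Polynomial R) {i n : ℕ} (h : i ≤ n) :
    incl n (truncate n ((delta φ)^[i] (ofPoly f))) = (delta φ)^[i] (ofPoly f) := by
  obtain ⟨G, hG⟩ := delta_iterate_mem_range φ f i
  obtain ⟨H, hH⟩ := incl_mem_range h G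
  rw [← hG]
  simp only [AlgHom.toRingHom_eq_coe, RingHom.coe_coe] at hH ⊢
  rw [← hH, truncate_incl]

end JetRing

section Completion

/-- The `p`-adic completion of a ring. -/
abbrev PCompletion (p : ℕ) (A : Type*) [CommRing A] : Type _ :=
  AdicCompletion (Ideal.span {(p : A)}) A

/-- The canonical map of a ring to its `p`-adic completion. -/
def toPCompletion (p : ℕ) (A : Type*) [CommRing A] : A →+* PCompletion p A :=
  algebraMap A (AdicCompletion (Ideal.span {(p : A)}) A)

variable (p : ℕ) {A B : Type*} [CommRing A] [CommRing B]

theorem span_pow_le_comap (f : A →+* B) (k : ℕ) :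
    Ideal.span {(p : A)} ^ k ≤ (Ideal.span {(p : B)} ^ k).comap f := by
  rw [Ideal.span_singleton_pow, Ideal.span_singleton_pow, Ideal.span_singleton_le_iff_mem,
    Ideal.mem_comap, map_pow, map_natCast]
  exact Ideal.mem_span_singleton_self _

/-- The map `Â → B / p^k` induced by a ring homomorphism `A → B`. -/
def pCompletionMapMod (f : A →+* B) (k : ℕ) :
    PCompletion p A →+* B ⧸ Ideal.span {(p : B)} ^ k :=
  (Ideal.quotientMap (Ideal.span {(p : B)} ^ k) f (span_pow_le_comap p f k)).comp
    (AdicCompletion.evalₐ (Ideal.span {(p : A)}) k : PCompletion p A →+* _)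

theorem factorPow_comp_pCompletionMapMod (f : A →+* B) {m n : ℕ} (hle : m ≤ n) :
    (Ideal.Quotient.factorPow (Ideal.span {(p : B)}) hle).comp (pCompletionMapMod p f n)
      = pCompletionMapMod p f m := by
  ext x
  obtain ⟨a, rfl⟩ := AdicCompletion.mk_surjective _ _ x
  simp only [pCompletionMapMod, RingHom.comp_apply, RingHom.coe_coe, AdicCompletion.evalₐ_mk,
    Ideal.quotientMap_mk]
  have h := AdicCompletion.Ideal.mk_eq_mk (I := Ideal.span {(p : A)}) hle a
  rw [← Ideal.quotientMap_mk (H := span_pow_le_comap p f m) (x := a m), ← h,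
    Ideal.quotientMap_mk]
  rfl

/-- The map of `p`-adic completions induced by a ring homomorphism. -/
def pCompletionMap (f : A →+* B) : PCompletion p A →+* PCompletion p B :=
  AdicCompletion.liftRingHom (Ideal.span {(p : B)}) (pCompletionMapMod p f)
    (factorPow_comp_pCompletionMapMod p f)

theorem pCompletionMap_toPCompletion (f : A →+* B) (a : A) :
    pCompletionMap p f (toPCompletion p A a) = toPCompletion p B (f a) := by
  apply AdicCompletion.ext_evalₐ
  intro k
  refine (AdicCompletion.evalₐ_liftRingHom (Ideal.span {(p : B)}) (pCompletionMapMod p f)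
    (factorPow_comp_pCompletionMapMod p f) k _).trans ?_
  simp [toPCompletion, pCompletionMapMod]

end Completion

section Jet

variable {p : ℕ} [Fact p.Prime] {R : Type*} [CommRing R]
  (φ : FrobeniusLift p R) (I : Ideal (Polynomial R))

/-- The ideal `(f, δ f, …, δ^n f ; f ∈ I)` of the `p`-adic completion of `R[x, …, x^{(n)}]`. -/
def jetIdeal (n : ℕ) : Ideal (PCompletion p (JetPoly R n)) :=
  Ideal.span {g | ∃ f ∈ I, ∃ i ≤ n,
    g = toPCompletion p (JetPoly R n) (truncate n ((delta φ)^[i] (ofPoly f)))}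

/-- The ring `𝒪ⁿ(X)` of global functions on the `n`-th `p`-jet space of the closed subscheme
`X = Spec R[x]/I` of the affine line. -/
abbrev JetRing (n : ℕ) : Type _ := PCompletion p (JetPoly R n) ⧸ jetIdeal φ I n

/-- The reduction `𝒪ⁿ(X) / p 𝒪ⁿ(X)`. -/
abbrev JetRingModP (n : ℕ) : Type _ := JetRing φ I n ⧸ Ideal.span {(p : JetRing φ I n)}

/-- The class in `𝒪ⁿ(X) / p` of an element of `R[x, …, x^{(n)}] ⊆ R{x}`. -/
def jetClass (n : ℕ) : DiffPoly R →+* JetRingModP φ I n :=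
  (Ideal.Quotient.mk _).comp ((Ideal.Quotient.mk (jetIdeal φ I n)).comp
    ((toPCompletion p (JetPoly R n)).comp (truncate n : DiffPoly R →ₐ[R] JetPoly R n).toRingHom))

/-- The inclusion `R[x, …, x^{(n)}] → R[x, …, x^{(m)}]` for `n ≤ m`. -/
def jetPolyMap (R : Type*) [CommRing R] {n m : ℕ} (h : n ≤ m) : JetPoly R n →+* JetPoly R m :=
  (MvPolynomial.rename (Fin.castLE (Nat.succ_le_succ h)) : JetPoly R n →ₐ[R] JetPoly R m).toRingHom

theorem incl_jetPolyMap {n m : ℕ} (h : n ≤ m) (G : JetPoly R n) :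
    incl m (jetPolyMap R h G) = incl n G := by
  simp only [incl, jetPolyMap, AlgHom.toRingHom_eq_coe, RingHom.coe_coe]
  rw [MvPolynomial.rename_rename]; rfl

variable [IsDomain R] [IsCompleteLocalPRing p R]

theorem jetIdeal_le_comap {n m : ℕ} (h : n ≤ m) :
    jetIdeal φ I n ≤ (jetIdeal φ I m).comap (pCompletionMap p (jetPolyMap R h)) := by
  rw [jetIdeal, Ideal.span_le]
  rintro _ ⟨f, hf, i, hi, rfl⟩
  rw [SetLike.mem_coe, Ideal.mem_comap, pCompletionMap_toPCompletion]
  refine Ideal.subset_span ⟨f, hf, i, hi.trans h, ?_⟩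
  congr 1
  rw [← truncate_incl m (jetPolyMap R h _), incl_jetPolyMap,
    rename_truncate_delta_iterate φ f hi]

/-- The canonical map `𝒪ⁿ(X) → 𝒪ᵐ(X)` for `n ≤ m`. -/
def jetRingMap {n m : ℕ} (h : n ≤ m) : JetRing φ I n →+* JetRing φ I m :=
  Ideal.quotientMap _ (pCompletionMap p (jetPolyMap R h)) (jetIdeal_le_comap φ I h)

/-- The canonical map `𝒪ⁿ(X) / p → 𝒪ᵐ(X) / p` for `n ≤ m`. -/
def jetRingModPMap (n m : ℕ) (h : n ≤ m) : JetRingModP φ I n →+* JetRingModP φ I m :=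
  Ideal.quotientMap _ (jetRingMap φ I h) (by
    rw [Ideal.span_singleton_le_iff_mem, Ideal.mem_comap, map_natCast]
    exact Ideal.mem_span_singleton_self _)

/-- The direct limit of the rings `𝒪ⁿ(X) / p`. -/
abbrev LimitJetRingModP : Type _ :=
  Ring.DirectLimit (JetRingModP φ I) (fun n m h => jetRingModPMap φ I n m h)

/-- The map of `𝒪ⁿ(X) / p` to the direct limit. -/
def toLimit (n : ℕ) : JetRingModP φ I n →+* LimitJetRingModP φ I :=
  Ring.DirectLimit.of (JetRingModP φ I) (fun n m h => jetRingModPMap φ I n m h) n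

end Jet

section FormalGroupLaw

variable {R : Type*} [CommRing R]

/-- The coordinate `x`, as a point of `F` with values in `R⟦x⟧`. -/
def coordPoint (F : FormalGroup R) : F.Point Unit :=
  ⟨PowerSeries.X, PowerSeries.HasSubst.X'⟩

/-- The power series `[m](x)` of multiplication by `m` in a formal group law. -/
def mulSeries (F : FormalGroup R) (m : ℕ) : PowerSeries R :=
  (m • coordPoint F).val

/-- The height of the reduction mod `p` of `F`: the supremum of all `h` such that the reduction
mod `p` of `[p](x)` is a power series in `x^{p^h}`. It is `⊤` if `[p](x)` vanishes mod `p`. -/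
def height (p : ℕ) (F : FormalGroup R) : ℕ∞ :=
  ⨆ (h : ℕ) (_ : ∀ j : ℕ, ¬ p ^ h ∣ j →
    PowerSeries.coeff j
      (PowerSeries.map (Ideal.Quotient.mk (Ideal.span {(p : R)})) (mulSeries F p)) = 0), (h : ℕ∞)

/-- The ideal in `R[x]` of the kernel `F[m] = Spec R⟦x⟧ / ([m](x))` of multiplication by `m`,
regarded as a closed subscheme of the affine line with coordinate `x`. -/
def kernelIdeal (F : FormalGroup R) (m : ℕ) : Ideal (Polynomial R) :=
  (Ideal.span {mulSeries F m}).comap (Polynomial.coeToPowerSeries.ringHom (R := R))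

end FormalGroupLaw

end ArithmeticJet

end

noncomputable section

namespace ArithmeticJet

open WittVector

/-! ### Frobenius lifts, Witt components and iterates of a `p`-derivation -/

section WittLift

variable {p : ℕ} {A : Type*} [CommRing A]

/-! The limit is `R{x}/(p, δ^i f)`, with `f` in the ideal of the kernel: modulo `p` the completions
play no role, and each relation holds from a finite level on. So the claim is the equality of two
ideals of `R{x}`, `prolongationIdeal` and `powerIdeal`, and it is proved with Witt vectors.

For a proper ideal `J` containing `p`, put `B = R{x}/J`, a ring of characteristic `p`. The Frobenius
lift gives a ring map `R{x} → W(R{x}) → W(B)` (`wittLift`, `wittPoint`); let `w` be the image of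
`x`. The `n`-th Witt component of `a` is `δ^n a` modulo `(a, …, δ^(n-1) a)`
(`wittComponent_sub_iterate_mem`). Hence `J` contains all `δ^n f` iff `f(w) = 0`, and all
`(x^{(n)})^(p^ν)` iff `F^ν w = 0`, where `F` is the Witt vector Frobenius. What remains is that
`[p^ν](w) = 0` iff `F^ν w = 0`.

Write `[p](x) = p x u + x^d v` with units `u`, `v`, where `d` is the order of `[p]` mod `p`. In
`W(B)` one has `p = VF`. If `F w = 0`, then `p w = 0` and `w^p = 0`
(`pow_eq_zero_of_frobenius_eq_zero`), so `[p](w) = 0` because `p ∣ d`. Conversely, `[p](w) = 0`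
makes `p w` a unit multiple of `w^d`. If `F w` is in `V^m`, then `w^d` is in `V^(m+2)`
(`pow_mem_truncIdeal_of_frobenius_mem`), so `V F w = p w` is too and `F w` is in `V^(m+1)`; thus `F
w = 0`. The gain needs `p m ≥ m + 2`, which fails only for `p = 2`, `m = 1`. The start is `m = r`
with `p^r ∣ d`, and height at least `2` provides `r = 2`. Iterating `[p]`, with coefficients twisted
by `F`, gives the case of `p^ν`.

That `p ∣ d` comes from points over the dual numbers (`dvd_of_isPUnitForm`). Weierstrass preparation
passes between the series `[p^ν]` and polynomials in its ideal, and makes `w` nilpotent modulo each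
`V^n`. -/

theorem exists_add_mul_pow_sub_pow_eq [hp : Fact p.Prime] (y z : A) (m : ℕ) :
    ∃ q : A, (y + p * z) ^ p ^ m - y ^ p ^ m = p ^ (m + 1) * (z * q) := by
  induction m with
  | zero => exact ⟨1, by simp⟩
  | succ m ih =>
    obtain ⟨q, hq⟩ := ih
    obtain ⟨r, hr⟩ := exists_add_pow_prime_eq hp.out (y ^ p ^ m) (p ^ (m + 1) * (z * q))
    obtain ⟨t, ht⟩ : ∃ t, p = t + 2 := ⟨p - 2, by have := hp.out.two_le; omega⟩
    have h1 : (y + p * z) ^ p ^ m = y ^ p ^ m + p ^ (m + 1) * (z * q) := by rw [← hq]; ring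
    have h2 : ((p : A) ^ (m + 1) * (z * q)) ^ p
        = p ^ (m + 1 + 1) * (z * (q * ((p : A) ^ m * (p ^ (m + 1) * (z * q)) ^ t * (z * q)))) := by
      conv_lhs => rw [show ((p : A) ^ (m + 1) * (z * q)) ^ p
        = ((p : A) ^ (m + 1) * (z * q)) ^ (t + 2) by rw [← ht]]
      ring
    rw [pow_succ p m, pow_mul, pow_mul, h1, hr, h2]
    exact ⟨q * ((p : A) ^ m * (p ^ (m + 1) * (z * q)) ^ t * (z * q)) + y ^ p ^ m * q * r, by ring⟩

/-- A cofactor in the congruence `f(y) ^ p^m ≡ y ^ p^(m+1)`. -/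
def powCofactor [Fact p.Prime] (d : A → A) (m : ℕ) (y : A) : A :=
  Classical.choose (exists_add_mul_pow_sub_pow_eq (p := p) (y ^ p) (d y) m)

theorem powCofactor_spec [Fact p.Prime] (d : A → A) (m : ℕ) (y : A) :
    (y ^ p + p * d y) ^ p ^ m - (y ^ p) ^ p ^ m
      = p ^ (m + 1) * (d y * powCofactor (p := p) d m y) :=
  Classical.choose_spec (exists_add_mul_pow_sub_pow_eq (p := p) (y ^ p) (d y) m)

/-- The Witt components of the Witt vector with ghost components `a, f(a), f(f(a)), …`, where
`f(y) = y^p + p d(y)`. -/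
def wittComponent (p : ℕ) [Fact p.Prime] (d : A → A) (a : A) : ℕ → A
  | 0 => a
  -- The recursion of Dwork's lemma. The explicit factor `d w_i` is what later allows a comparison
  -- with iterates of `d`.
  | n + 1 => ∑ i : Fin (n + 1),
      d (wittComponent p d a i) * powCofactor (p := p) d (n - i) (wittComponent p d a i)

theorem wittComponent_zero [Fact p.Prime] (d : A → A) (a : A) : wittComponent p d a 0 = a := by
  rw [wittComponent]

theorem wittComponent_succ [Fact p.Prime] (d : A → A) (a : A) (n : ℕ) :
    wittComponent p d a (n + 1) = ∑ i ∈ Finset.range (n + 1),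
      d (wittComponent p d a i) * powCofactor (p := p) d (n - i) (wittComponent p d a i) := by
  rw [wittComponent, Finset.sum_range]

/-- Applying `f` to the `n`-th ghost component replaces `w_i ^ p` by `w_i ^ p + p d(w_i)`. The total
change is `p^(n+1)` times the sum defining `w_(n+1)`, which is exactly the missing last term of the
next ghost component. -/
theorem mk_wittComponent_ghost [Fact p.Prime] {f : A →+* A} {d : A → A}
    (hd : ∀ a, (p : A) * d a = f a - a ^ p) (a : A) (n : ℕ) :
    ghostComponent n (WittVector.mk p (wittComponent p d a)) = f^[n] a := by
  rw [ghostComponent_apply, aeval_wittPolynomial]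
  simp only [coeff_mk]
  induction n with
  | zero => simp [wittComponent_zero]
  | succ n ih =>
    rw [Function.iterate_succ_apply', ← ih, map_sum, Finset.sum_range_succ, wittComponent_succ,
      Nat.sub_self, pow_zero, pow_one, Finset.mul_sum, ← Finset.sum_add_distrib]
    refine Finset.sum_congr rfl fun i hi => ?_
    have hi : i ≤ n := Nat.lt_succ_iff.mp (Finset.mem_range.mp hi)
    have hf : f (wittComponent p d a i)
        = wittComponent p d a i ^ p + p * d (wittComponent p d a i) := by rw [hd]; ring
    have h := powCofactor_spec (p := p) d (n - i) (wittComponent p d a i)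
    have h2 : (p : A) ^ (n + 1) = p ^ i * p ^ (n - i + 1) := by
      rw [← pow_add]; congr 1; omega
    have h3 : p ^ (n + 1 - i) = p * p ^ (n - i) := by
      rw [← pow_succ']; congr 1; omega
    rw [map_mul, map_pow, map_pow, map_natCast, hf, h2, h3, mul_assoc (_ ^ i), ← h, pow_mul]
    ring

/-- The ideal `(a, d a, …, d^(n-1) a)`. -/
def iterateIdeal (d : A → A) (a : A) (n : ℕ) : Ideal A :=
  Ideal.span {b | ∃ i < n, b = d^[i] a}

theorem iterateIdeal_mono (d : A → A) (a : A) {n m : ℕ} (h : n ≤ m) :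
    iterateIdeal d a n ≤ iterateIdeal d a m :=
  Ideal.span_mono fun _ ⟨i, hi, hb⟩ => ⟨i, hi.trans_le h, hb⟩

theorem iterate_mem_iterateIdeal (d : A → A) (a : A) {i n : ℕ} (h : i < n) :
    d^[i] a ∈ iterateIdeal d a n := Ideal.subset_span ⟨i, h, rfl⟩

variable [IsDomain A]

/-- The `n`-th ghost component determines `p^n x_n` once the earlier components are known, and `p^n`
cancels. Ring identities for `wittLift` can therefore be checked on ghost components. -/
theorem ghostMap_injective_of_natCast_ne_zero [Fact p.Prime] (hp0 : (p : A) ≠ 0) :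
    Function.Injective (WittVector.ghostMap : WittVector p A → ℕ → A) := by
  intro x y h
  ext n
  induction n using Nat.strong_induction_on with
  | _ n ih =>
    have h1 := congrFun h n
    rw [ghostMap_apply, ghostMap_apply, ghostComponent_apply, ghostComponent_apply,
      aeval_wittPolynomial, aeval_wittPolynomial, Finset.sum_range_succ, Finset.sum_range_succ,
      Finset.sum_congr rfl fun i hi => by rw [ih i (Finset.mem_range.mp hi)]] at h1
    simpa [hp0] using h1

/-- A ring with no `p`-torsion and a lift `f` of Frobenius maps to its ring of Witt vectors so that
the ghost components of the image of `a` are `a, f(a), f(f(a)), …`. -/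
def wittLift [Fact p.Prime] (hp0 : (p : A) ≠ 0) {f : A →+* A} {d : A → A}
    (hd : ∀ a, (p : A) * d a = f a - a ^ p) : A →+* WittVector p A where
  toFun a := WittVector.mk p (wittComponent p d a)
  map_one' := ghostMap_injective_of_natCast_ne_zero hp0 <| funext fun n => by
    simp [ghostMap_apply, mk_wittComponent_ghost hd, iterate_map_one]
  map_zero' := ghostMap_injective_of_natCast_ne_zero hp0 <| funext fun n => by
    simp [ghostMap_apply, mk_wittComponent_ghost hd, iterate_map_zero]
  map_mul' a b := ghostMap_injective_of_natCast_ne_zero hp0 <| funext fun n => by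
    simp [ghostMap_apply, mk_wittComponent_ghost hd, iterate_map_mul]
  map_add' a b := ghostMap_injective_of_natCast_ne_zero hp0 <| funext fun n => by
    simp [ghostMap_apply, mk_wittComponent_ghost hd, iterate_map_add]

section Derivation

variable (hp0 : (p : A) ≠ 0) {f : A →+* A} {d : A → A}
  (hd : ∀ a, (p : A) * d a = f a - a ^ p)

include hp0 hd

theorem pDerivation_mul (a b : A) : d (a * b) = a ^ p * d b + d a * f b := by
  apply mul_left_cancel₀ hp0
  have h : (p : A) * (a ^ p * d b + d a * f b) = a ^ p * (p * d b) + (p * d a) * f b := by ring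
  rw [h, hd, hd, hd, map_mul, mul_pow]
  ring

variable [hp : Fact p.Prime]

theorem exists_pDerivation_add (a b : A) : ∃ r, d (a + b) = d a + d b + a * b * r := by
  obtain ⟨r, hr⟩ := exists_add_pow_prime_eq hp.out a b
  refine ⟨-r, mul_left_cancel₀ hp0 ?_⟩
  rw [mul_add, mul_add, hd, hd, hd, hr, map_add]
  ring

theorem pDerivation_zero : d 0 = 0 := by
  apply mul_left_cancel₀ hp0
  rw [hd, map_zero, zero_pow hp.out.ne_zero, sub_zero, mul_zero]

theorem pDerivation_mem_iterateIdeal {a b : A} {n : ℕ} (hb : b ∈ iterateIdeal d a n) :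
    d b ∈ iterateIdeal d a (n + 1) := by
  have hle := iterateIdeal_mono d a (Nat.le_succ n)
  induction hb using Submodule.span_induction with
  | mem x hx =>
    obtain ⟨i, hi, rfl⟩ := hx
    rw [← Function.iterate_succ_apply' d]
    exact iterate_mem_iterateIdeal d a (Nat.succ_lt_succ hi)
  | zero => rw [pDerivation_zero hp0 hd]; exact zero_mem _
  | add x y hx hy ihx ihy =>
    obtain ⟨r, hr⟩ := exists_pDerivation_add hp0 hd x y
    rw [hr]
    exact add_mem (add_mem ihx ihy)
      (Ideal.mul_mem_right _ _ (Ideal.mul_mem_right _ _ (hle hx)))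
  | smul c x hx ihx =>
    rw [smul_eq_mul, mul_comm, pDerivation_mul hp0 hd]
    exact add_mem (Ideal.mul_mem_right _ _ (Ideal.pow_mem_of_mem _ (hle hx) _ hp.out.pos))
      (Ideal.mul_mem_right _ _ ihx)

/-- In the recursion for `w_(n+1)` the terms with `i < n` involve only iterates of order at most
`n`, and the term `i = n` equals `d(w_n)`. Since `d(s + t) - d s - d t` is a multiple of `s t`,
replacing `w_n` by `d^n a` inside `d` costs only elements of the ideal. -/
theorem wittComponent_sub_iterate_mem (a : A) (n : ℕ) :
    wittComponent p d a n - d^[n] a ∈ iterateIdeal d a n := by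
  induction n using Nat.strong_induction_on with
  | _ n ih =>
    cases n with
    | zero => simp [wittComponent_zero]
    | succ n =>
      have hmem : ∀ i < n + 1, wittComponent p d a i ∈ iterateIdeal d a (i + 1) := fun i hi => by
        have h := add_mem (iterateIdeal_mono d a (Nat.le_succ i) (ih i hi))
          (iterate_mem_iterateIdeal d a (Nat.lt_succ_self i))
        rwa [sub_add_cancel] at h
      have hlast : d (wittComponent p d a n) * powCofactor (p := p) d 0 (wittComponent p d a n)
          = d (wittComponent p d a n) := by
        apply mul_left_cancel₀ hp0
        have h := powCofactor_spec (p := p) d 0 (wittComponent p d a n)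
        rw [pow_zero, pow_one, pow_one, zero_add, pow_one] at h
        rw [← h]; ring
      obtain ⟨r, hr⟩ := exists_pDerivation_add hp0 hd (wittComponent p d a n - d^[n] a) (d^[n] a)
      rw [sub_add_cancel] at hr
      rw [wittComponent_succ, Finset.sum_range_succ, Nat.sub_self, hlast, hr,
        Function.iterate_succ_apply']
      have hn := ih n (Nat.lt_succ_self n)
      have h : ∀ s t u v : A, s + (t + u + v) - u = s + t + v := fun s t u v => by ring
      rw [h]
      refine add_mem (add_mem (sum_mem fun i hi => ?_) (pDerivation_mem_iterateIdeal hp0 hd hn))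
        (Ideal.mul_mem_right _ _ (Ideal.mul_mem_right _ _ (iterateIdeal_mono d a n.le_succ hn)))
      have hi := Finset.mem_range.mp hi
      exact Ideal.mul_mem_right _ _ (iterateIdeal_mono d a (by omega)
        (pDerivation_mem_iterateIdeal hp0 hd (hmem i (by omega))))

theorem iterate_mem_of_wittComponent_mem {J : Ideal A} {a : A}
    (h : ∀ n, wittComponent p d a n ∈ J) (n : ℕ) : d^[n] a ∈ J := by
  induction n using Nat.strong_induction_on with
  | _ n ih =>
    have hle : iterateIdeal d a n ≤ J := Ideal.span_le.mpr fun b ⟨i, hi, hb⟩ => hb ▸ ih i hi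
    have h1 := sub_mem (h n) (hle (wittComponent_sub_iterate_mem hp0 hd a n))
    rwa [sub_sub_cancel] at h1

theorem wittComponent_mem_of_iterate_mem {J : Ideal A} {a : A}
    (h : ∀ n, d^[n] a ∈ J) (n : ℕ) : wittComponent p d a n ∈ J := by
  have hle : iterateIdeal d a n ≤ J := Ideal.span_le.mpr fun b ⟨i, hi, hb⟩ => hb ▸ h i
  have h1 := add_mem (hle (wittComponent_sub_iterate_mem hp0 hd a n)) (h n)
  rwa [sub_add_cancel] at h1

/-- Modulo an ideal that contains `p`, the `p^ν`-th powers of the Witt components of `a` and of the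
elements `d^n a` generate the same ideal. -/
theorem pow_wittComponent_mem_iff {J : Ideal A} (hpJ : (p : A) ∈ J) (a : A) (ν : ℕ) :
    (∀ n, wittComponent p d a n ^ p ^ ν ∈ J) ↔ ∀ n, (d^[n] a) ^ p ^ ν ∈ J := by
  have key : ∀ x y : A, (x + y) ^ p ^ ν - (x ^ p ^ ν + y ^ p ^ ν) ∈ J := fun x y => by
    obtain ⟨r, hr⟩ := exists_add_pow_prime_pow_eq hp.out x y ν
    rw [hr]
    have h : x ^ p ^ ν + y ^ p ^ ν + p * x * y * r - (x ^ p ^ ν + y ^ p ^ ν) = p * (x * y * r) := by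
      ring
    rw [h]
    exact Ideal.mul_mem_right _ _ hpJ
  have hpos : 0 < p ^ ν := pow_pos hp.out.pos ν
  have hI : ∀ n, (∀ i < n, (d^[i] a) ^ p ^ ν ∈ J) → ∀ b ∈ iterateIdeal d a n, b ^ p ^ ν ∈ J := by
    intro n hn b hb
    induction hb using Submodule.span_induction with
    | mem x hx => obtain ⟨i, hi, rfl⟩ := hx; exact hn i hi
    | zero => rw [zero_pow hpos.ne']; exact zero_mem _
    | add x y _ _ ihx ihy =>
      have h := add_mem (key x y) (add_mem ihx ihy)
      rwa [sub_add_cancel] at h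
    | smul c x _ ihx => rw [smul_eq_mul, mul_pow]; exact Ideal.mul_mem_left _ _ ihx
  -- The two elements differ by a combination of earlier iterates. Its `p^ν`-th power is in `J`, as
  -- this power is additive modulo `p`.
  have hiff : ∀ n, (∀ i < n, (d^[i] a) ^ p ^ ν ∈ J) →
      (wittComponent p d a n ^ p ^ ν ∈ J ↔ (d^[n] a) ^ p ^ ν ∈ J) := fun n hn => by
    have h1 := hI n hn _ (wittComponent_sub_iterate_mem hp0 hd a n)
    have h2 := key (wittComponent p d a n - d^[n] a) (d^[n] a)
    rw [sub_add_cancel] at h2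
    have h3 := add_mem h2 h1
    have h4 : ∀ s t u : A, s - (t + u) + t = s - u := fun s t u => by ring
    rw [h4] at h3
    exact ⟨fun h => by simpa using sub_mem h h3,
      fun h => by simpa using add_mem h3 h⟩
  constructor
  · intro h n
    induction n using Nat.strong_induction_on with
    | _ n ih => exact (hiff n ih).mp (h n)
  · intro h n
    exact (hiff n fun i _ => h i).mpr (h n)

end Derivation

end WittLift

/-! ### Frobenius, Verschiebung and powers in Witt vectors of characteristic `p` -/

section WittCharP

variable {p : ℕ} [hp : Fact p.Prime] {B : Type*} [CommRing B]

/-- The ideal of Witt vectors whose first `n` components vanish. -/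
abbrev truncIdeal (p : ℕ) [Fact p.Prime] (B : Type*) [CommRing B] (n : ℕ) :
    Ideal (WittVector p B) := RingHom.ker (WittVector.truncate (p := p) (R := B) n)

theorem mem_truncIdeal {n : ℕ} {x : WittVector p B} :
    x ∈ truncIdeal p B n ↔ ∀ i < n, x.coeff i = 0 := WittVector.mem_ker_truncate n x

theorem iterate_verschiebung_mem_truncIdeal (n : ℕ) (x : WittVector p B) :
    verschiebung^[n] x ∈ truncIdeal p B n :=
  mem_truncIdeal.mpr fun _ hi => iterate_verschiebung_coeff_eq_zero x hi

theorem truncIdeal_antitone {m n : ℕ} (h : m ≤ n) : truncIdeal p B n ≤ truncIdeal p B m :=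
  fun _ hx => mem_truncIdeal.mpr fun i hi => mem_truncIdeal.mp hx i (hi.trans_le h)

theorem exists_iterate_verschiebung {n : ℕ} {x : WittVector p B} (h : x ∈ truncIdeal p B n) :
    ∃ y, x = verschiebung^[n] y := ⟨_, eq_iterate_verschiebung (mem_truncIdeal.mp h)⟩

/-- A Witt vector is the sum of its first `m` components and a multiple of `V^m`. -/
theorem exists_eq_add_iterate_verschiebung (m : ℕ) (x : WittVector p B) :
    ∃ a b, x = a + verschiebung^[m] b ∧
      ∀ i, a.coeff i = if i < m then x.coeff i else 0 := by
  have h := WittVector.init_add_tail x m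
  obtain ⟨b, hb⟩ : ∃ b, WittVector.tail m x = verschiebung^[m] b :=
    exists_iterate_verschiebung (mem_truncIdeal.mpr fun i hi => by
      simp [WittVector.tail, WittVector.select, hi])
  refine ⟨WittVector.init m x, b, ?_, fun i => ?_⟩
  · rw [← hb, h]
  · simp [WittVector.init, WittVector.select]

variable [CharP B p]

/-- In characteristic `p`, `V^i a * V^j b = V^(i+j)(F^j a * F^i b)`. -/
theorem mul_mem_truncIdeal {i j : ℕ} {x y : WittVector p B} (hx : x ∈ truncIdeal p B i)
    (hy : y ∈ truncIdeal p B j) : x * y ∈ truncIdeal p B (i + j) := by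
  obtain ⟨a, rfl⟩ := exists_iterate_verschiebung hx
  obtain ⟨b, rfl⟩ := exists_iterate_verschiebung hy
  rw [iterate_verschiebung_mul]
  exact iterate_verschiebung_mem_truncIdeal _ _

theorem pow_mem_truncIdeal {i : ℕ} {x : WittVector p B} (hx : x ∈ truncIdeal p B i) (n : ℕ) :
    x ^ n ∈ truncIdeal p B (n * i) := by
  induction n with
  | zero => exact mem_truncIdeal.mpr fun j hj => by omega
  | succ n ih => rw [pow_succ, Nat.succ_mul]; exact mul_mem_truncIdeal ih hx

/-- Multiplication by `p` is `VF`, and `V` shifts components by one. -/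
theorem mul_natCast_mem_truncIdeal_iff {n : ℕ} {x : WittVector p B} :
    x * p ∈ truncIdeal p B (n + 1) ↔ frobenius x ∈ truncIdeal p B n := by
  rw [mem_truncIdeal, mem_truncIdeal, ← verschiebung_frobenius]
  constructor
  · intro h i hi
    have := h (i + 1) (by omega)
    rwa [verschiebung_coeff_add_one] at this
  · intro h i hi
    cases i with
    | zero => exact verschiebung_coeff_zero _
    | succ i => rw [verschiebung_coeff_add_one]; exact h i (by omega)

theorem frobenius_mem_truncIdeal {n : ℕ} {x : WittVector p B} (h : x ∈ truncIdeal p B n) :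
    frobenius x ∈ truncIdeal p B n :=
  mem_truncIdeal.mpr fun i hi => by
    rw [coeff_frobenius_charP, mem_truncIdeal.mp h i hi, zero_pow hp.out.ne_zero]

theorem natCast_mem_truncIdeal : (p : WittVector p B) ∈ truncIdeal p B 1 :=
  mem_truncIdeal.mpr fun i hi => by
    rw [Nat.lt_one_iff.mp hi, coeff_p_zero]

theorem mul_natCast_eq_zero_of_frobenius_eq_zero {x : WittVector p B} (h : frobenius x = 0) :
    x * p = 0 := by rw [← verschiebung_frobenius, h, map_zero]

/-- Write `x = [x₀] + V b`. Then `[x₀]^p = [x₀^p] = 0`, the cross term is `V(b * F[x₀]) = 0`, and `F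
b = 0` gives `(V b)^2 = V(b * p b) = 0`. The binomial expansion of `x^p` vanishes term by term. -/
theorem pow_eq_zero_of_frobenius_eq_zero {x : WittVector p B} (h : frobenius x = 0) :
    x ^ p = 0 := by
  have hc : ∀ i, x.coeff i ^ p = 0 := fun i => by
    rw [← coeff_frobenius_charP, h, zero_coeff]
  obtain ⟨a, b, hx, ha⟩ := exists_eq_add_iterate_verschiebung 1 x
  rw [Function.iterate_one] at hx
  have hat : a = teichmuller p (x.coeff 0) := by
    ext i
    rw [ha]
    cases i with
    | zero => simp
    | succ i => rw [if_neg (by omega), teichmuller_coeff_pos _ _ _ (by omega)]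
  have hap : a ^ p = 0 := by rw [hat, ← map_pow, hc, teichmuller_zero]
  have hFa : frobenius a = 0 := by
    ext i
    rw [coeff_frobenius_charP, ha, zero_coeff]
    split_ifs
    · exact hc i
    · exact zero_pow hp.out.ne_zero
  have hFb : frobenius b = 0 := by
    have h1 : frobenius (verschiebung b) = 0 := by
      rw [hx, map_add, hFa, zero_add] at h; exact h
    apply verschiebung_injective
    rw [verschiebung_frobenius, ← frobenius_verschiebung, h1, map_zero]
  have hab : a * verschiebung b = 0 := by
    rw [mul_comm, ← verschiebung_mul_frobenius, hFa, mul_zero, map_zero]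
  have hbb : verschiebung b ^ 2 = 0 := by
    rw [pow_two, ← verschiebung_mul_frobenius, frobenius_verschiebung,
      mul_natCast_eq_zero_of_frobenius_eq_zero hFb, mul_zero, map_zero]
  obtain ⟨r, hr⟩ := exists_add_pow_prime_eq hp.out a (verschiebung b)
  rw [hx, hr, hap, pow_eq_zero_of_le hp.out.two_le hbb, mul_assoc (p : WittVector p B), hab]
  ring

theorem pow_pow_eq_zero_of_iterate_frobenius_eq_zero {ν : ℕ} {x : WittVector p B}
    (h : frobenius^[ν] x = 0) : x ^ p ^ ν = 0 := by
  induction ν generalizing x with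
  | zero => simpa using h
  | succ ν ih =>
    rw [pow_succ', pow_mul]
    apply ih
    rw [iterate_map_pow]
    exact pow_eq_zero_of_frobenius_eq_zero (by rwa [Function.iterate_succ_apply'] at h)

/-- With `y = x - [c]` in `V^m`, the expansion of `([c] + y)^p` leaves `y^p` in `V^(p m)` and a
multiple of `p y`, which is in `V^(m+1)` because `p` is in `V`. -/
theorem pow_sub_teichmuller_mem {m : ℕ} (hm : 1 ≤ m) {x : WittVector p B} {c : B}
    (h : x - teichmuller p c ∈ truncIdeal p B m) :
    x ^ p - teichmuller p (c ^ p) ∈ truncIdeal p B (m + 1) := by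
  obtain ⟨r, hr⟩ := exists_add_pow_prime_eq hp.out (x - teichmuller p c) (teichmuller p c)
  rw [sub_add_cancel] at hr
  rw [hr, map_pow]
  have h1 : ∀ s t u : WittVector p B, s + t + u - t = s + u := fun s t u => by ring
  rw [h1]
  refine add_mem ?_ (Ideal.mul_mem_right _ _ (Ideal.mul_mem_right _ _ ?_))
  · refine truncIdeal_antitone ?_ (pow_mem_truncIdeal h p)
    nlinarith [hp.out.two_le]
  · rw [add_comm]; exact mul_mem_truncIdeal natCast_mem_truncIdeal h

theorem pow_pow_sub_teichmuller_mem (x : WittVector p B) (r : ℕ) :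
    x ^ p ^ r - teichmuller p (x.coeff 0 ^ p ^ r) ∈ truncIdeal p B (r + 1) := by
  induction r with
  | zero =>
    rw [pow_zero, pow_one, pow_one, mem_truncIdeal]
    intro i hi
    obtain rfl : i = 0 := by omega
    have h : (constantCoeff (x - teichmuller p (x.coeff 0)) : B) = 0 := by
      rw [map_sub]; simp [WittVector.constantCoeff]
    exact h
  | succ r ih =>
    rw [pow_succ, pow_mul, pow_mul]
    exact pow_sub_teichmuller_mem (by omega) ih

/-- Modulo `V^(r+1)` the power `x^(p^r)` is a Teichmüller element, so `x^d` is congruent to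
`[x₀^d]`. This starts the induction on the order of `F x`. -/
theorem pow_mem_truncIdeal_of_coeff_zero_pow {x : WittVector p B} {d r : ℕ} (hr : p ^ r ∣ d)
    (h : x.coeff 0 ^ d = 0) : x ^ d ∈ truncIdeal p B (r + 1) := by
  obtain ⟨e, rfl⟩ := hr
  have h1 := Ideal.Quotient.eq.mpr (pow_pow_sub_teichmuller_mem x r)
  have h2 : teichmuller p (x.coeff 0 ^ p ^ r) ^ e = 0 := by
    rw [← map_pow, ← pow_mul, h, teichmuller_zero]
  rw [← Ideal.Quotient.eq_zero_iff_mem, pow_mul, map_pow, h1, ← map_pow, h2, map_zero]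

/-- Split `x = a + V^m b` with `a` the first `m` components. The hypothesis says exactly that `F a =
0`, so `a^p = 0` and `a * V^m b = 0`. Hence `x^p = (V^m b)^p` is in `V^(p m)`, and `p m ≥ m + 2`
outside the case `p = 2`, `m = 1`. -/
theorem pow_mem_truncIdeal_of_frobenius_mem {x : WittVector p B} {d m : ℕ} (hm : 1 ≤ m)
    (hpm : p ≠ 2 ∨ 2 ≤ m) (hpd : p ∣ d) (hd : d ≠ 0) (h : frobenius x ∈ truncIdeal p B m) :
    x ^ d ∈ truncIdeal p B (m + 2) := by
  obtain ⟨e, rfl⟩ := hpd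
  have he : e ≠ 0 := by rintro rfl; simp at hd
  obtain ⟨a, b, hx, ha⟩ := exists_eq_add_iterate_verschiebung m x
  have hFa : frobenius a = 0 := by
    ext i
    rw [coeff_frobenius_charP, ha, zero_coeff]
    split_ifs with hi
    · rw [← coeff_frobenius_charP, mem_truncIdeal.mp h i hi]
    · exact zero_pow hp.out.ne_zero
  have hab : a * verschiebung^[m] b = 0 := by
    obtain ⟨k, rfl⟩ : ∃ k, m = k + 1 := ⟨m - 1, by omega⟩
    rw [mul_comm, iterate_verschiebung_mul_left, Function.iterate_succ_apply frobenius, hFa,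
      iterate_map_zero, mul_zero, iterate_map_zero]
  obtain ⟨r, hr⟩ := exists_add_pow_prime_eq hp.out a (verschiebung^[m] b)
  rw [pow_mul, hx, hr, pow_eq_zero_of_frobenius_eq_zero hFa, mul_assoc (p : WittVector p B), hab,
    mul_zero, zero_mul, add_zero, zero_add]
  refine Ideal.pow_mem_of_mem _ (truncIdeal_antitone ?_
    (pow_mem_truncIdeal (iterate_verschiebung_mem_truncIdeal m b) p)) _ (Nat.pos_of_ne_zero he)
  rcases hpm with h2 | h2
  · have : 3 ≤ p := by have := hp.out.two_le; omega
    nlinarith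
  · nlinarith [hp.out.two_le]

/-- If `p x` is a multiple of `x ^ d` modulo `V^(n+1)`, then `F x` is divisible by `V^n`. -/
theorem frobenius_mem_truncIdeal_of_mul_natCast_sub_mem {d r n : ℕ} (hd : d ≠ 0) (hr : 1 ≤ r)
    (hrd : p ^ r ∣ d) (hpr : p ≠ 2 ∨ 2 ≤ r) {x y z : WittVector p B}
    (hxy : x * (p : WittVector p B) - x ^ d * y ∈ truncIdeal p B (n + 1))
    (hyz : y * z - 1 ∈ truncIdeal p B (n + 1)) :
    frobenius x ∈ truncIdeal p B n := by
  have hpd : p ∣ d := (dvd_pow_self p (by omega)).trans hrd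
  -- On component zero `p` vanishes and `y` is invertible.
  have h0 : x.coeff 0 ^ d = 0 := by
    have h1 : (constantCoeff (x * (p : WittVector p B) - x ^ d * y) : B) = 0 := mem_truncIdeal.mp hxy 0 (by omega)
    have h2 : (constantCoeff (y * z - 1) : B) = 0 := mem_truncIdeal.mp hyz 0 (by omega)
    rw [map_sub, map_mul, map_mul, map_natCast, CharP.cast_eq_zero, mul_zero, zero_sub,
      neg_eq_zero, map_pow] at h1
    rw [map_sub, map_mul, map_one, sub_eq_zero] at h2
    calc x.coeff 0 ^ d = x.coeff 0 ^ d * (constantCoeff y * constantCoeff z) := by rw [h2, mul_one]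
      _ = 0 := by rw [← mul_assoc]; erw [h1]; rw [zero_mul]
  have hmul : ∀ m ≤ n, x ^ d ∈ truncIdeal p B (m + 1) →
      frobenius x ∈ truncIdeal p B m := by
    intro m hm h
    rw [← mul_natCast_mem_truncIdeal_iff]
    have := add_mem (truncIdeal_antitone (Nat.succ_le_succ hm) hxy) (Ideal.mul_mem_right y _ h)
    rwa [sub_add_cancel] at this
  -- From `F x` in `V^m` follows `x^d` in `V^(m+2)`, one level more than `hmul` needs to recover `F
  -- x` in `V^m`; so the order of `F x` grows by one.
  have key : ∀ k, r + k ≤ n → frobenius x ∈ truncIdeal p B (r + k) := by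
    intro k
    induction k with
    | zero => exact fun h => hmul _ (by omega) (pow_mem_truncIdeal_of_coeff_zero_pow hrd h0)
    | succ k ih =>
      intro h
      exact hmul (r + k + 1) (by omega) (pow_mem_truncIdeal_of_frobenius_mem (m := r + k) (by omega)
        (hpr.imp_right fun h => by omega) hpd hd (ih (by omega)))
  rcases le_total r n with h | h
  · have := key (n - r) (by omega)
    rwa [Nat.add_sub_cancel' h] at this
  · exact hmul n le_rfl (truncIdeal_antitone (by omega)
      (pow_mem_truncIdeal_of_coeff_zero_pow hrd h0))

end WittCharP

/-! ### Evaluation of power series at nilpotent elements -/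

section NilpotentEvaluation

variable {S T : Type*} [CommRing S] [CommRing T]

theorem hasSubst_C_of_isNilpotent {w : S} (hw : IsNilpotent w) :
    PowerSeries.HasSubst (MvPowerSeries.C w : MvPowerSeries Empty S) := by
  change IsNilpotent (MvPowerSeries.constantCoeff (MvPowerSeries.C w))
  rwa [MvPowerSeries.constantCoeff_C]

/-- The value of a power series at a nilpotent element. -/
def nilpEval (w : S) (hw : IsNilpotent w) : PowerSeries S →+* S :=
  -- A series in no variables is a constant, so substituting the constant series `w` amounts to
  -- evaluating at `w`.
  (MvPowerSeries.constantCoeff (σ := Empty) (R := S)).comp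
    (PowerSeries.substAlgHom (R := S) (hasSubst_C_of_isNilpotent hw)).toRingHom

variable {w : S} (hw : IsNilpotent w)

theorem C_nilpEval (f : PowerSeries S) :
    (MvPowerSeries.C (nilpEval w hw f) : MvPowerSeries Empty S)
      = f.subst (MvPowerSeries.C w : MvPowerSeries Empty S) := by
  ext e
  obtain rfl : e = 0 := Subsingleton.elim _ _
  rw [MvPowerSeries.coeff_zero_eq_constantCoeff_apply,
    MvPowerSeries.coeff_zero_eq_constantCoeff_apply, MvPowerSeries.constantCoeff_C,
    ← PowerSeries.coe_substAlgHom (hasSubst_C_of_isNilpotent hw)]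
  rfl

theorem nilpEval_eq_of_C_eq {a : S} {f : PowerSeries S}
    (h : f.subst (MvPowerSeries.C w : MvPowerSeries Empty S) = MvPowerSeries.C a) :
    nilpEval w hw f = a := by
  rw [← C_nilpEval hw] at h
  simpa using congrArg MvPowerSeries.constantCoeff h

theorem nilpEval_congr {w' : S} (hw' : IsNilpotent w') (h : w = w') (f : PowerSeries S) :
    nilpEval w hw f = nilpEval w' hw' f := by
  subst h; rfl

@[simp]
theorem nilpEval_C (a : S) : nilpEval w hw (PowerSeries.C a) = a :=
  nilpEval_eq_of_C_eq hw (PowerSeries.subst_C _)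

@[simp]
theorem nilpEval_X : nilpEval w hw PowerSeries.X = w :=
  nilpEval_eq_of_C_eq hw (PowerSeries.subst_X (hasSubst_C_of_isNilpotent hw))

theorem nilpEval_coe (f : Polynomial S) : nilpEval w hw (f : PowerSeries S) = f.eval w := by
  induction f using Polynomial.induction_on' with
  | add f g hf hg => rw [Polynomial.coe_add, map_add, hf, hg, Polynomial.eval_add]
  | monomial n a =>
    rw [← Polynomial.C_mul_X_pow_eq_monomial]
    simp

theorem isNilpotent_nilpEval {f : PowerSeries S} (hf : PowerSeries.constantCoeff f = 0) :
    IsNilpotent (nilpEval w hw f) := by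
  obtain ⟨g, rfl⟩ := PowerSeries.X_dvd_iff.mpr hf
  rw [map_mul, nilpEval_X]
  exact (Commute.all _ _).isNilpotent_mul_right hw

theorem nilpEval_subst (f : PowerSeries S) {g : PowerSeries S}
    (hg : PowerSeries.constantCoeff g = 0) :
    nilpEval w hw (f.subst g) = nilpEval (nilpEval w hw g) (isNilpotent_nilpEval hw hg) f := by
  apply nilpEval_eq_of_C_eq
  rw [PowerSeries.subst_comp_subst_apply (PowerSeries.HasSubst.of_constantCoeff_zero' hg)
    (hasSubst_C_of_isNilpotent hw), ← C_nilpEval hw,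
    ← C_nilpEval (isNilpotent_nilpEval hw hg)]

theorem map_nilpEval (σ : S →+* T) (f : PowerSeries S) :
    σ (nilpEval w hw f) = nilpEval (σ w) (hw.map σ) (PowerSeries.map σ f) := by
  symm
  apply nilpEval_eq_of_C_eq
  have h := PowerSeries.map_subst (hasSubst_C_of_isNilpotent hw) (h := σ) f
  rw [MvPowerSeries.map_C] at h
  rw [← h, ← C_nilpEval hw, MvPowerSeries.map_C]

end NilpotentEvaluation

/-! ### Iterates of power series and the form `p x u + x^d v` -/

section Iterate

variable {S T : Type*} [CommRing S] [CommRing T]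

/-- The iterates `g ∘ ⋯ ∘ g` of a power series without constant coefficient. -/
def substIterate (g : PowerSeries S) : ℕ → PowerSeries S
  | 0 => PowerSeries.X
  | ν + 1 => g.subst (substIterate g ν)

theorem constantCoeff_substIterate {g : PowerSeries S} (hg : PowerSeries.constantCoeff g = 0)
    (ν : ℕ) : PowerSeries.constantCoeff (substIterate g ν) = 0 := by
  induction ν with
  | zero => exact PowerSeries.constantCoeff_X
  | succ ν ih => exact PowerSeries.constantCoeff_subst_eq_zero ih _ hg

theorem map_substIterate (σ : S →+* T) {g : PowerSeries S}
    (hg : PowerSeries.constantCoeff g = 0) (ν : ℕ) :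
    PowerSeries.map σ (substIterate g ν) = substIterate (PowerSeries.map σ g) ν := by
  induction ν with
  | zero => exact PowerSeries.map_X σ
  | succ ν ih =>
    rw [substIterate, substIterate, ← ih]
    exact PowerSeries.map_subst
      (PowerSeries.HasSubst.of_constantCoeff_zero' (constantCoeff_substIterate hg ν)) g

/-- A power series `p x u(x) + x^d v(x)` with units `u` and `v`. -/
def IsPUnitForm (p d : ℕ) (g : PowerSeries S) : Prop :=
  ∃ u v : PowerSeries S, IsUnit u ∧ IsUnit v ∧
    g = PowerSeries.X * PowerSeries.C (p : S) * u + PowerSeries.X ^ d * v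

theorem IsPUnitForm.map (σ : S →+* T) {p d : ℕ} {g : PowerSeries S} (h : IsPUnitForm p d g) :
    IsPUnitForm p d (PowerSeries.map σ g) := by
  obtain ⟨u, v, hu, hv, rfl⟩ := h
  exact ⟨PowerSeries.map σ u, PowerSeries.map σ v, hu.map _, hv.map _, by simp⟩

theorem IsPUnitForm.constantCoeff {p d : ℕ} (hd : d ≠ 0) {g : PowerSeries S}
    (h : IsPUnitForm p d g) : PowerSeries.constantCoeff g = 0 := by
  obtain ⟨u, v, hu, hv, rfl⟩ := h
  simp [hd]

end Iterate

/-! ### Zeros of the iterates of `p x u + x^d v` in Witt vectors -/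

section WittTorsion

variable {p : ℕ} [hp : Fact p.Prime] {B : Type*} [CommRing B] [CharP B p]

theorem isNilpotent_of_iterate_frobenius_eq_zero {ν : ℕ} {w : WittVector p B}
    (h : frobenius^[ν] w = 0) : IsNilpotent w :=
  ⟨_, pow_pow_eq_zero_of_iterate_frobenius_eq_zero h⟩

/-- Applying `F` to the value of an iterate at `w` gives the iterate of the twisted series at `F w`,
which is zero by induction; this is why `g` varies. A last application of `g` kills any element
killed by `F`. -/
theorem nilpEval_substIterate_eq_zero {d ν : ℕ} (hd : d ≠ 0) (hpd : p ∣ d)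
    {g : PowerSeries (WittVector p B)} (hg : IsPUnitForm p d g) {w : WittVector p B}
    (h : frobenius^[ν] w = 0) :
    nilpEval w (isNilpotent_of_iterate_frobenius_eq_zero h) (substIterate g ν) = 0 := by
  induction ν generalizing g w with
  | zero => simpa [substIterate] using h
  | succ ν ih =>
    have hw := isNilpotent_of_iterate_frobenius_eq_zero h
    have hF : frobenius (nilpEval w hw (substIterate g ν)) = 0 := by
      rw [map_nilpEval, map_substIterate _ (hg.constantCoeff hd)]
      exact ih (hg.map frobenius) h
    rw [substIterate, nilpEval_subst hw g (constantCoeff_substIterate (hg.constantCoeff hd) ν)]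
    have key : ∀ (x : WittVector p B) (hx : IsNilpotent x), frobenius x = 0 →
        nilpEval x hx g = 0 := fun x hx hFx => by
      obtain ⟨u, v, -, -, rfl⟩ := hg
      obtain ⟨e, rfl⟩ := hpd
      have he : e ≠ 0 := by rintro rfl; simp at hd
      rw [map_add, map_mul, map_mul, map_mul, map_pow, nilpEval_X, nilpEval_C,
        mul_natCast_eq_zero_of_frobenius_eq_zero hFx, pow_mul,
        pow_eq_zero_of_frobenius_eq_zero hFx, zero_pow he]
      ring
    exact key _ _ hF

/-- Some power of `w` lies in `V`, and its `n`-th power lies in `V^n`. As `w` itself need not be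
nilpotent, series are evaluated modulo each `V^n`. -/
theorem isNilpotent_mk_truncIdeal {w : WittVector p B} (hw : IsNilpotent (w.coeff 0)) (n : ℕ) :
    IsNilpotent (Ideal.Quotient.mk (truncIdeal p B n) w) := by
  obtain ⟨N, hN⟩ := hw
  have h1 : w ^ N ∈ truncIdeal p B 1 := mem_truncIdeal.mpr fun i hi => by
    obtain rfl : i = 0 := by omega
    have : (constantCoeff (w ^ N) : B) = 0 := by rw [map_pow]; exact hN
    exact this
  refine ⟨N * n, ?_⟩
  rw [← map_pow, Ideal.Quotient.eq_zero_iff_mem, pow_mul]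
  simpa using pow_mem_truncIdeal h1 n

theorem frobenius_mem_of_nilpEval_eq_zero {d r n : ℕ} (hd : d ≠ 0) (hr : 1 ≤ r)
    (hrd : p ^ r ∣ d) (hpr : p ≠ 2 ∨ 2 ≤ r) {g : PowerSeries (WittVector p B)}
    (hg : IsPUnitForm p d g) {w : WittVector p B}
    (hw : IsNilpotent (Ideal.Quotient.mk (truncIdeal p B (n + 1)) w))
    (h : nilpEval _ hw (PowerSeries.map (Ideal.Quotient.mk (truncIdeal p B (n + 1))) g) = 0) :
    frobenius w ∈ truncIdeal p B n := by
  obtain ⟨u, v, hu, hv, rfl⟩ := hg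
  obtain ⟨u', hu'⟩ := (hu.map (PowerSeries.map (Ideal.Quotient.mk (truncIdeal p B (n + 1))))).map
    (nilpEval _ hw)
  obtain ⟨v', hv'⟩ := (hv.map (PowerSeries.map (Ideal.Quotient.mk (truncIdeal p B (n + 1))))).map
    (nilpEval _ hw)
  -- Dividing `p w u + w^d v = 0` by `u` gives `p w = w^d y` with `y = -v u⁻¹`; the lifts `y` and
  -- `z` are inverse only modulo `V^(n+1)`.
  obtain ⟨y, hy⟩ := Ideal.Quotient.mk_surjective (-(↑(v' * u'⁻¹) : _ ⧸ truncIdeal p B (n + 1)))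
  obtain ⟨z, hz⟩ := Ideal.Quotient.mk_surjective (-(↑(v' * u'⁻¹)⁻¹ : _ ⧸ truncIdeal p B (n + 1)))
  refine frobenius_mem_truncIdeal_of_mul_natCast_sub_mem hd hr hrd hpr (y := y) (z := z) ?_ ?_
  · simp only [map_add, map_mul, map_pow, PowerSeries.map_X, PowerSeries.map_C, nilpEval_X,
      nilpEval_C, ← hu', ← hv'] at h
    rw [← Ideal.Quotient.eq_zero_iff_mem, map_sub, map_mul, map_mul, map_pow, hy]
    have h1 := congrArg (· * (↑u'⁻¹ : _ ⧸ truncIdeal p B (n + 1))) h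
    simp only [zero_mul] at h1
    rw [← h1, add_mul, mul_assoc _ (u' : _ ⧸ truncIdeal p B (n + 1)), Units.mul_inv, Units.val_mul]
    ring
  · rw [← Ideal.Quotient.eq_zero_iff_mem, map_sub, map_mul, map_one, hy, hz, neg_mul_neg,
      Units.mul_inv, sub_self]

/-- If the `ν`-th iterate of `g` vanishes at `w` modulo `V^n`, then `V^(n-ν)` divides `F^ν w`. -/
theorem iterate_frobenius_mem_of_nilpEval_eq_zero {d r : ℕ} (hd : d ≠ 0) (hr : 1 ≤ r)
    (hrd : p ^ r ∣ d) (hpr : p ≠ 2 ∨ 2 ≤ r) {ν n : ℕ} {g : PowerSeries (WittVector p B)}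
    (hg : IsPUnitForm p d g) {w : WittVector p B}
    (hw : IsNilpotent (Ideal.Quotient.mk (truncIdeal p B (n + ν)) w))
    (h : nilpEval _ hw
      (PowerSeries.map (Ideal.Quotient.mk (truncIdeal p B (n + ν))) (substIterate g ν)) = 0) :
    frobenius^[ν] w ∈ truncIdeal p B n := by
  induction ν generalizing g w with
  | zero =>
    rw [substIterate, PowerSeries.map_X, nilpEval_X, Ideal.Quotient.eq_zero_iff_mem] at h
    exact h
  | succ ν ih =>
    have hg0 := hg.constantCoeff hd
    set q := Ideal.Quotient.mk (truncIdeal p B (n + (ν + 1))) with hq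
    -- Here `v` lifts the value of the `ν`-th iterate, a zero of `g`. Each application of `g` costs
    -- one level of truncation.
    obtain ⟨v, hv⟩ := Ideal.Quotient.mk_surjective
      (nilpEval _ hw (PowerSeries.map q (substIterate g ν)))
    have hnil : IsNilpotent (q v) := by
      rw [hq, hv, map_substIterate _ hg0]
      exact isNilpotent_nilpEval _ (constantCoeff_substIterate ((hg.map _).constantCoeff hd) _)
    have h1 : frobenius v ∈ truncIdeal p B (n + ν) := by
      refine frobenius_mem_of_nilpEval_eq_zero (n := n + ν) hd hr hrd hpr hg hnil ?_
      rw [map_substIterate _ hg0, substIterate, nilpEval_subst hw _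
        (constantCoeff_substIterate ((hg.map _).constantCoeff hd) _)] at h
      rw [← h]
      refine nilpEval_congr _ _ ?_ _
      rw [← map_substIterate _ hg0]
      exact hv
    have hle : truncIdeal p B (n + (ν + 1)) ≤ (truncIdeal p B (n + ν)).comap WittVector.frobenius :=
      fun x hx => frobenius_mem_truncIdeal (truncIdeal_antitone (Nat.le_succ (n + ν)) hx)
    -- Frobenius turns `F v ≡ 0` into the vanishing of the iterate of the twisted series at `F w`,
    -- one level lower.
    have h2 := congrArg (Ideal.quotientMap _ WittVector.frobenius hle) hv
    rw [Ideal.quotientMap_mk, Ideal.Quotient.eq_zero_iff_mem.mpr h1, map_nilpEval] at h2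
    have hcomp : PowerSeries.map (Ideal.quotientMap _ WittVector.frobenius hle)
          (PowerSeries.map q (substIterate g ν))
        = PowerSeries.map (Ideal.Quotient.mk (truncIdeal p B (n + ν)))
          (PowerSeries.map WittVector.frobenius (substIterate g ν)) := by
      ext i; simp [hq]
    rw [Function.iterate_succ_apply]
    refine ih (hg.map frobenius) (w := frobenius w) ?_ ?_
    · have := hw.map (Ideal.quotientMap _ WittVector.frobenius hle)
      rwa [Ideal.quotientMap_mk] at this
    · rw [← map_substIterate _ hg0]
      rw [hcomp] at h2
      exact h2.symm

/-- If the iterate of `g` vanishes at `w` modulo all `V^n`, then `F^ν w = 0`. -/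
theorem iterate_frobenius_eq_zero {d r : ℕ} (hd : d ≠ 0) (hr : 1 ≤ r)
    (hrd : p ^ r ∣ d) (hpr : p ≠ 2 ∨ 2 ≤ r) {ν : ℕ} {g : PowerSeries (WittVector p B)}
    (hg : IsPUnitForm p d g) {w : WittVector p B} (hw : IsNilpotent (w.coeff 0))
    (h : ∀ n, nilpEval _ (isNilpotent_mk_truncIdeal hw n)
      (PowerSeries.map (Ideal.Quotient.mk (truncIdeal p B n)) (substIterate g ν)) = 0) :
    frobenius^[ν] w = 0 := by
  ext n
  rw [zero_coeff]
  exact mem_truncIdeal.mp (iterate_frobenius_mem_of_nilpEval_eq_zero hd hr hrd hpr hg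
    (isNilpotent_mk_truncIdeal hw (n + 1 + ν)) (h (n + 1 + ν))) n n.lt_succ_self

end WittTorsion

/-! ### Points of formal groups and additivity of multiplication by `m` -/

section Points

variable {R S : Type*} [CommRing R] [CommRing S] {σ τ : Type*} (F : FormalGroup R)

theorem hasSubst_pair {f g : MvPowerSeries σ R} (hf : PowerSeries.HasSubst f)
    (hg : PowerSeries.HasSubst g) : MvPowerSeries.HasSubst ![f, g] :=
  MvPowerSeries.hasSubst_of_constantCoeff_nilpotent fun s => by fin_cases s <;> assumption

/-- Substitution of power series in the coordinates of points of a formal group. -/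
def pointSubst [Finite σ] (a : σ → MvPowerSeries τ R) (ha : ∀ s, PowerSeries.HasSubst (a s)) :
    F.Point σ →+ F.Point τ where
  toFun P := ⟨P.val.subst a, MvPowerSeries.IsNilpotent_subst
    (MvPowerSeries.hasSubst_of_constantCoeff_nilpotent ha) P.prop⟩
  map_zero' := Subtype.ext <| by
    change MvPowerSeries.subst a 0 = 0
    rw [← MvPowerSeries.coe_substAlgHom (MvPowerSeries.hasSubst_of_constantCoeff_nilpotent ha),
      map_zero]
  map_add' P Q := Subtype.ext <| by
    change MvPowerSeries.subst a (MvPowerSeries.subst ![P.val, Q.val] F.toPowerSeries) = _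
    rw [MvPowerSeries.subst_comp_subst_apply (hasSubst_pair P.prop Q.prop)
      (MvPowerSeries.hasSubst_of_constantCoeff_nilpotent ha)]
    change _ = MvPowerSeries.subst _ F.toPowerSeries
    congr 1
    ext s : 1
    fin_cases s <;> rfl

theorem pointSubst_val [Finite σ] (a : σ → MvPowerSeries τ R)
    (ha : ∀ s, PowerSeries.HasSubst (a s)) (P : F.Point σ) :
    (pointSubst F a ha P).val = P.val.subst a := rfl

/-- The image of a point of a formal group under a ring homomorphism. -/
def pointMap (f : R →+* S) : F.Point σ →+ (F.map f).Point σ where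
  toFun P := ⟨MvPowerSeries.map f P.val, by
    have h : IsNilpotent (MvPowerSeries.constantCoeff P.val) := P.prop
    change IsNilpotent (MvPowerSeries.constantCoeff (MvPowerSeries.map f P.val))
    rw [MvPowerSeries.constantCoeff_map]
    exact h.map f⟩
  map_zero' := Subtype.ext <| map_zero (MvPowerSeries.map f)
  map_add' P Q := Subtype.ext <| by
    change MvPowerSeries.map f (MvPowerSeries.subst ![P.val, Q.val] F.toPowerSeries) = _
    rw [MvPowerSeries.map_subst (hasSubst_pair P.prop Q.prop)]
    change _ = MvPowerSeries.subst _ (MvPowerSeries.map f F.toPowerSeries)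
    congr 1
    ext s : 1
    fin_cases s <;> rfl

theorem pointMap_val (f : R →+* S) (P : F.Point σ) :
    (pointMap F f P).val = MvPowerSeries.map f P.val := rfl

/-- Every point is the coordinate point with its own value substituted, and substitution is additive
on points. -/
theorem nsmul_val (P : F.Point σ) (n : ℕ) :
    (n • P).val = (mulSeries F n).subst P.val := by
  have h : pointSubst F (fun _ : Unit => P.val) (fun _ => P.prop) (coordPoint F) = P :=
    Subtype.ext (PowerSeries.subst_X P.prop)
  conv_lhs => rw [← h]
  rw [← map_nsmul]
  rfl

theorem constantCoeff_mulSeries (n : ℕ) : PowerSeries.constantCoeff (mulSeries F n) = 0 := by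
  have h := nsmul_val F (0 : F.Point Unit) n
  rw [smul_zero, FormalGroup.zero_apply] at h
  have h2 := congrArg (MvPowerSeries.constantCoeff) h
  rw [PowerSeries.constantCoeff_subst PowerSeries.HasSubst.zero] at h2
  rw [finsum_eq_single _ 0 (fun d hd => by simp [hd])] at h2
  simpa using h2.symm

theorem hasSubst_mulSeries (n : ℕ) : PowerSeries.HasSubst (mulSeries F n) :=
  PowerSeries.HasSubst.of_constantCoeff_zero' (constantCoeff_mulSeries F n)

theorem mulSeries_mul (m n : ℕ) :
    mulSeries F (m * n) = (mulSeries F n).subst (mulSeries F m) := by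
  have h : mulSeries F (m * n) = ((m * n) • coordPoint F).val := rfl
  rw [h, mul_nsmul, nsmul_val]
  rfl

theorem mulSeries_one : mulSeries F 1 = PowerSeries.X := by
  have h : mulSeries F 1 = (1 • coordPoint F).val := rfl
  rw [h, one_nsmul]
  rfl

theorem mulSeries_pow (p ν : ℕ) : mulSeries F (p ^ ν) = substIterate (mulSeries F p) ν := by
  induction ν with
  | zero => exact mulSeries_one F
  | succ ν ih => rw [pow_succ, mulSeries_mul, ih]; rfl

theorem mulSeries_map (f : R →+* S) (n : ℕ) :
    mulSeries (F.map f) n = PowerSeries.map f (mulSeries F n) := by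
  have h : pointMap F f (coordPoint F) = coordPoint (F.map f) :=
    Subtype.ext (PowerSeries.map_X f)
  have h2 : mulSeries (F.map f) n = (n • coordPoint (F.map f)).val := rfl
  rw [h2, ← h, ← map_nsmul]
  rfl

/-- The lowest coefficient of `H(a(x), b(x))`. -/
theorem coeff_subst_pair {H : MvPowerSeries (Fin 2) R} {j : ℕ}
    (hH : ∀ e : Fin 2 →₀ ℕ, e 0 + e 1 < j → MvPowerSeries.coeff e H = 0)
    {a b : PowerSeries R} (ha : PowerSeries.constantCoeff a = 0)
    (hb : PowerSeries.constantCoeff b = 0) :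
    PowerSeries.coeff j (MvPowerSeries.subst ![a, b] H : PowerSeries R)
      = ∑ i ∈ Finset.range (j + 1),
          MvPowerSeries.coeff (Finsupp.single 0 i + Finsupp.single 1 (j - i)) H
            * (PowerSeries.coeff 1 a ^ i * PowerSeries.coeff 1 b ^ (j - i)) := by
  have hsub : MvPowerSeries.HasSubst ![a, b] :=
    hasSubst_pair (PowerSeries.HasSubst.of_constantCoeff_zero' ha)
      (PowerSeries.HasSubst.of_constantCoeff_zero' hb)
  obtain ⟨a, rfl⟩ := PowerSeries.X_dvd_iff.mpr ha
  obtain ⟨b, rfl⟩ := PowerSeries.X_dvd_iff.mpr hb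
  have hprod : ∀ e : Fin 2 →₀ ℕ,
      (e.prod fun s k => (![PowerSeries.X * a, PowerSeries.X * b] s : PowerSeries R) ^ k)
        = PowerSeries.X ^ (e 0 + e 1) * (a ^ e 0 * b ^ e 1) := fun e => by
    rw [Finsupp.prod_fintype _ _ (fun _ => pow_zero _), Fin.prod_univ_two]
    simp only [Matrix.cons_val_zero, Matrix.cons_val_one]
    ring
  have hcoeff : ∀ e : Fin 2 →₀ ℕ, MvPowerSeries.coeff e H ≠ 0 →
      PowerSeries.coeff j (PowerSeries.X ^ (e 0 + e 1) * (a ^ e 0 * b ^ e 1))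
        = if e 0 + e 1 = j then
          PowerSeries.coeff 1 (PowerSeries.X * a) ^ e 0
            * PowerSeries.coeff 1 (PowerSeries.X * b) ^ e 1 else 0 := fun e he => by
    rw [PowerSeries.coeff_X_pow_mul']
    have hj : j ≤ e 0 + e 1 := not_lt.mp fun h => he (hH e h)
    by_cases h : e 0 + e 1 = j
    · rw [if_pos h.le, if_pos h, h, Nat.sub_self]
      simp [PowerSeries.coeff_succ_X_mul (n := 0)]
    · rw [if_neg (by omega), if_neg h]
  rw [PowerSeries.coeff, MvPowerSeries.coeff_subst hsub]
  simp only [hprod]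
  rw [finsum_eq_sum_of_support_subset (s := (Finset.range (j + 1)).image
    fun i => Finsupp.single 0 i + Finsupp.single 1 (j - i))]
  · rw [Finset.sum_image]
    · refine Finset.sum_congr rfl fun i hi => ?_
      rw [smul_eq_mul]
      by_cases h0 : MvPowerSeries.coeff (Finsupp.single 0 i + Finsupp.single 1 (j - i)) H = 0
      · rw [h0, zero_mul, zero_mul]
      · have hi := Finset.mem_range.mp hi
        have h := hcoeff _ h0
        rw [if_pos (by simp; omega)] at h
        congr 1
        refine h.trans ?_
        simp
    · intro i _ i' _ h
      simpa using DFunLike.congr_fun h 0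
  · intro e he
    rw [Function.mem_support] at he
    have h0 : MvPowerSeries.coeff e H ≠ 0 := left_ne_zero_of_smul he
    have h1 : PowerSeries.coeff j (PowerSeries.X ^ (e 0 + e 1) * (a ^ e 0 * b ^ e 1)) ≠ 0 :=
      right_ne_zero_of_smul he
    rw [hcoeff e h0] at h1
    have h2 : e 0 + e 1 = j := by by_contra h; simp [h] at h1
    rw [Finset.coe_image]
    refine ⟨e 0, by simp; omega, ?_⟩
    ext s
    fin_cases s
    · simp
    · simp; omega

theorem coeff_one_add_val {P Q : F.Point Unit}
    (hP : PowerSeries.constantCoeff (R := R) P.val = 0)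
    (hQ : PowerSeries.constantCoeff (R := R) Q.val = 0) :
    PowerSeries.coeff (R := R) 1 (P + Q).val
      = PowerSeries.coeff (R := R) 1 P.val + PowerSeries.coeff (R := R) 1 Q.val := by
  rw [FormalGroup.add_apply]
  refine (coeff_subst_pair (fun e he => ?_) hP hQ).trans ?_
  · obtain rfl : e = 0 := by
      ext s; fin_cases s
      · simp; omega
      · simp; omega
    exact F.zero_constantCoeff
  · simp [Finset.sum_range_succ, F.lin_coeff_X, F.lin_coeff_Y, add_comm]

theorem constantCoeff_add_val {P Q : F.Point Unit}
    (hP : PowerSeries.constantCoeff (R := R) P.val = 0)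
    (hQ : PowerSeries.constantCoeff (R := R) Q.val = 0) :
    PowerSeries.constantCoeff (R := R) (P + Q).val = 0 := by
  rw [FormalGroup.add_apply, ← PowerSeries.coeff_zero_eq_constantCoeff_apply]
  refine (coeff_subst_pair (fun e he => by omega) hP hQ).trans ?_
  have h := F.zero_constantCoeff
  rw [← MvPowerSeries.coeff_zero_eq_constantCoeff_apply] at h
  simp [h]

theorem coeff_one_mulSeries (n : ℕ) : PowerSeries.coeff 1 (mulSeries F n) = n := by
  induction n with
  | zero =>
    have h : mulSeries F 0 = (0 • coordPoint F).val := rfl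
    rw [h, zero_nsmul, FormalGroup.zero_apply]
    simp
  | succ n ih =>
    have h : mulSeries F (n + 1) = ((n + 1) • coordPoint F).val := rfl
    rw [h, succ_nsmul, coeff_one_add_val F (constantCoeff_mulSeries F n)
      PowerSeries.constantCoeff_X, Nat.cast_succ]
    congr 1
    exact PowerSeries.coeff_one_X

/-- A power series in two variables over a domain of characteristic zero vanishes if it vanishes at
`([n](x), x)` for all `n`. -/
theorem eq_zero_of_subst_mulSeries [IsDomain R] [CharZero R] {H : MvPowerSeries (Fin 2) R}
    (hH : ∀ n : ℕ,
      (MvPowerSeries.subst ![mulSeries F n, PowerSeries.X] H : PowerSeries R) = 0) : H = 0 := by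
  have key : ∀ j, ∀ e : Fin 2 →₀ ℕ, e 0 + e 1 = j → MvPowerSeries.coeff e H = 0 := by
    intro j
    induction j using Nat.strong_induction_on with
    | _ j ih =>
      intro e he
      -- The degree `j` form of `H` at `(n, 1)`, as a polynomial in `n`. It is the lowest
      -- coefficient of `H([n](x), x)`, since `[n](x)` begins with `n x`.
      let P : Polynomial R := ∑ i ∈ Finset.range (j + 1), Polynomial.monomial i
        (MvPowerSeries.coeff (Finsupp.single 0 i + Finsupp.single 1 (j - i)) H)
      have hroot : ∀ n : ℕ, P.IsRoot n := fun n => by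
        have h := coeff_subst_pair (fun e he => ih _ he e rfl) (constantCoeff_mulSeries F n)
          (PowerSeries.constantCoeff_X (R := R))
        rw [hH n] at h
        simp only [coeff_one_mulSeries, PowerSeries.coeff_one_X, one_pow, mul_one, map_zero] at h
        simp only [P, Polynomial.IsRoot, Polynomial.eval_finsetSum, Polynomial.eval_monomial]
        exact h.symm
      have hP : P = 0 := Polynomial.eq_zero_of_infinite_isRoot P <|
        (Set.infinite_range_of_injective (Nat.cast_injective (R := R))).mono <| by
          rintro _ ⟨n, rfl⟩; exact hroot n
      have h := congrArg (fun Q => Polynomial.coeff Q (e 0)) hP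
      simp only [P, Polynomial.finsetSum_coeff, Polynomial.coeff_monomial,
        Polynomial.coeff_zero] at h
      rw [Finset.sum_ite_eq' (Finset.range (j + 1)) (e 0), if_pos (by simp; omega)] at h
      rw [← h]
      congr 2
      ext s
      fin_cases s
      · simp
      · simp; omega
  ext e
  exact key _ e rfl

/-- Over a domain of characteristic zero, multiplication by `m` in a formal group is additive. -/
theorem nsmul_add_coordinates [IsDomain R] [CharZero R] (m : ℕ) (P Q : F.Point (Fin 2))
    (hP : P.val = MvPowerSeries.X 0) (hQ : Q.val = MvPowerSeries.X 1) :
    m • (P + Q) = m • P + m • Q := by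
  apply Subtype.ext
  rw [← sub_eq_zero]
  refine eq_zero_of_subst_mulSeries F fun n => ?_
  have hs : ∀ s, PowerSeries.HasSubst (![mulSeries F n, PowerSeries.X] s) := fun s => by
    fin_cases s
    · exact hasSubst_mulSeries F n
    · exact PowerSeries.HasSubst.X'
  have hsub := MvPowerSeries.hasSubst_of_constantCoeff_nilpotent hs
  have h1 : pointSubst F _ hs P = n • coordPoint F := Subtype.ext <| by
    rw [pointSubst_val, hP, MvPowerSeries.subst_X hsub]; rfl
  have h2 : pointSubst F _ hs Q = coordPoint F := Subtype.ext <| by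
    rw [pointSubst_val, hQ, MvPowerSeries.subst_X hsub]; rfl
  -- After the substitution both points are multiples of a single point, where additivity needs no
  -- commutativity.
  have h3 : pointSubst F _ hs (m • (P + Q)) = pointSubst F _ hs (m • P + m • Q) := by
    rw [map_add, map_nsmul, map_nsmul, map_nsmul, map_add, h1, h2, ← mul_nsmul', ← add_nsmul,
      ← succ_nsmul, ← mul_nsmul', mul_add_one]
  rw [← MvPowerSeries.coe_substAlgHom hsub, map_sub, MvPowerSeries.coe_substAlgHom hsub,
    sub_eq_zero]
  exact congrArg Subtype.val h3

/-- The identity for the two coordinates over `R` is universal: apply `f` to the coefficients and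
substitute `P` and `Q`. It thus reaches rings of characteristic `p`, where the density argument is
unavailable. -/
theorem map_nsmul_add [IsDomain R] [CharZero R] (f : R →+* S) (m : ℕ)
    (P Q : (F.map f).Point Unit) : m • (P + Q) = m • P + m • Q := by
  let X₀ : F.Point (Fin 2) := ⟨MvPowerSeries.X 0, PowerSeries.HasSubst.X 0⟩
  let X₁ : F.Point (Fin 2) := ⟨MvPowerSeries.X 1, PowerSeries.HasSubst.X 1⟩
  have hs : ∀ s, PowerSeries.HasSubst (![P.val, Q.val] s) := fun s => by
    fin_cases s
    · exact P.prop
    · exact Q.prop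
  have hsub := MvPowerSeries.hasSubst_of_constantCoeff_nilpotent hs
  have h := congrArg (fun T => pointSubst (F.map f) _ hs (pointMap F f T))
    (nsmul_add_coordinates F m X₀ X₁ rfl rfl)
  have h1 : pointSubst (F.map f) _ hs (pointMap F f X₀) = P := Subtype.ext <| by
    rw [pointSubst_val, pointMap_val, MvPowerSeries.map_X, MvPowerSeries.subst_X hsub]; rfl
  have h2 : pointSubst (F.map f) _ hs (pointMap F f X₁) = Q := Subtype.ext <| by
    rw [pointSubst_val, pointMap_val, MvPowerSeries.map_X, MvPowerSeries.subst_X hsub]; rfl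
  simpa only [map_add, map_nsmul, h1, h2] using h

end Points

theorem charP_of_natCast_eq_zero {p : ℕ} (hp : p.Prime) {k : Type*} [CommRing k] [Nontrivial k]
    (h : (p : k) = 0) : CharP k p := by
  obtain ⟨q, hq⟩ := CharP.exists k
  rcases (Nat.dvd_prime hp).mp ((CharP.cast_eq_zero_iff k q p).mp h) with rfl | rfl
  · exact (CharP.false_of_nontrivial_of_char_one (R := k)).elim
  · exact hq

/-! ### The shape of `[p](x)` and Weierstrass preparation -/

section PUnitForm

variable {p : ℕ} [hp : Fact p.Prime] {R : Type*} [CommRing R] [IsDomain R]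
  [IsCompleteLocalPRing p R]

omit hp in
theorem isUnit_iff_not_natCast_dvd (a : R) : IsUnit a ↔ ¬ (p : R) ∣ a := by
  rw [← IsLocalRing.notMem_maximalIdeal, IsCompleteLocalPRing.maximalIdeal_eq (p := p),
    Ideal.mem_span_singleton]

omit hp in
theorem not_isUnit_natCast : ¬ IsUnit (p : R) := by
  rw [isUnit_iff_not_natCast_dvd (p := p), not_not]

theorem charZero_of_isCompleteLocalPRing (p : ℕ) [hp : Fact p.Prime] (R : Type*) [CommRing R]
    [IsDomain R] [IsCompleteLocalPRing p R] : CharZero R := by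
  refine charZero_of_inj_zero fun n hn => ?_
  by_contra h0
  obtain ⟨m, hm, hnm⟩ := (Nat.finiteMultiplicity_iff.mpr
    ⟨hp.out.ne_one, Nat.pos_of_ne_zero h0⟩).exists_eq_pow_mul_and_not_dvd
  rw [hm, Nat.cast_mul, Nat.cast_pow] at hn
  have hm0 : (m : R) = 0 := (mul_eq_zero.mp hn).resolve_left (pow_ne_zero _ natCast_ne_zero)
  have hco : IsCoprime (p : ℤ) m :=
    Nat.isCoprime_iff_coprime.mpr ((Nat.Prime.coprime_iff_not_dvd hp.out).mpr hnm)
  obtain ⟨a, b, hab⟩ := hco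
  have h := congrArg (Int.cast : ℤ → R) hab
  push_cast at h
  rw [hm0, mul_zero, add_zero, mul_comm] at h
  exact not_isUnit_natCast (p := p) (R := R) (IsUnit.of_mul_eq_one _ h)

theorem charP_quotient_span_natCast (p : ℕ) [hp : Fact p.Prime] (R : Type*) [CommRing R]
    [IsDomain R] [IsCompleteLocalPRing p R] : CharP (R ⧸ Ideal.span {(p : R)}) p := by
  have hne : Ideal.span {(p : R)} ≠ ⊤ := by
    rw [Ne, Ideal.span_singleton_eq_top]
    exact not_isUnit_natCast
  have := Ideal.Quotient.nontrivial_iff.mpr hne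
  refine charP_of_natCast_eq_zero hp.out ?_
  rw [← map_natCast (Ideal.Quotient.mk (Ideal.span {(p : R)})), Ideal.Quotient.eq_zero_iff_mem]
  exact Ideal.mem_span_singleton_self _

omit hp in
-- Take for `d` the order of `g` modulo `p`. The coefficients below `d`, divided by `p`, give `x u`
-- with `u(0) = 1` because the linear coefficient is `p`; the others give `x^d v`, where `v(0)` is a
-- unit.
theorem exists_isPUnitForm {g : PowerSeries R} (h0 : PowerSeries.constantCoeff g = 0)
    (h1 : PowerSeries.coeff 1 g = p) (hg : ∃ j, ¬ (p : R) ∣ PowerSeries.coeff j g) :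
    ∃ d, 2 ≤ d ∧ ¬ (p : R) ∣ PowerSeries.coeff d g ∧ IsPUnitForm p d g := by
  classical
  let d := Nat.find hg
  have hd : ¬ (p : R) ∣ PowerSeries.coeff d g := Nat.find_spec hg
  have hlt : ∀ i < d, (p : R) ∣ PowerSeries.coeff i g := fun i hi => not_not.mp (Nat.find_min hg hi)
  have hd2 : 2 ≤ d := by
    by_contra h
    have : d = 0 ∨ d = 1 := by omega
    rcases this with h | h
    · rw [h] at hd; exact hd (by simp [h0])
    · rw [h] at hd; exact hd (by simp [h1])
  choose c hc using hlt
  let u : PowerSeries R := PowerSeries.mk fun i => if h : i + 1 < d then c (i + 1) h else 0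
  let v : PowerSeries R := PowerSeries.mk fun i => PowerSeries.coeff (i + d) g
  refine ⟨d, hd2, hd, u, v, ?_, ?_, ?_⟩
  · rw [PowerSeries.isUnit_iff_constantCoeff, ← PowerSeries.coeff_zero_eq_constantCoeff_apply]
    have h := hc 1 (by omega)
    rw [h1] at h
    have h3 : c 1 (by omega) = 1 :=
      mul_left_cancel₀ (natCast_ne_zero (p := p) (R := R)) (by rw [← h, mul_one])
    simp [u, h3, show 1 < d by omega]
  · rw [PowerSeries.isUnit_iff_constantCoeff, ← PowerSeries.coeff_zero_eq_constantCoeff_apply,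
      isUnit_iff_not_natCast_dvd (p := p)]
    simpa [v] using hd
  · ext i
    rw [map_add, PowerSeries.coeff_X_pow_mul', mul_assoc]
    cases i with
    | zero => simp [h0, show ¬ d = 0 by omega]
    | succ i =>
      rw [PowerSeries.coeff_succ_X_mul, PowerSeries.coeff_C_mul]
      by_cases h : i + 1 < d
      · rw [if_neg (by omega), add_zero, hc _ h]
        simp [u, h]
      · rw [if_pos (by omega)]
        simp [u, v, h, show i + 1 - d + d = i + 1 by omega]

theorem one_add_eps_pow {k : Type*} [CommRing k] (d : ℕ) :
    (1 + DualNumber.eps : DualNumber k) ^ d = 1 + (d : DualNumber k) * DualNumber.eps := by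
  induction d with
  | zero => simp
  | succ d ih =>
    have h := DualNumber.eps_mul_eps (R := k)
    rw [pow_succ, ih]
    push_cast
    linear_combination (d : DualNumber k) * h

theorem constantCoeff_subst_of_constantCoeff_eq_zero {S : Type*} [CommRing S] {a : PowerSeries S}
    (ha : PowerSeries.constantCoeff a = 0) (f : PowerSeries S) :
    PowerSeries.constantCoeff (f.subst a) = PowerSeries.constantCoeff f := by
  have hs := PowerSeries.HasSubst.of_constantCoeff_zero' ha
  obtain ⟨g, hg⟩ := PowerSeries.X_dvd_iff.mpr
    (show PowerSeries.constantCoeff (f - PowerSeries.C (PowerSeries.constantCoeff f)) = 0 by simp)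
  have h : f = PowerSeries.C (PowerSeries.constantCoeff f) + PowerSeries.X * g := by
    rw [← hg]; ring
  conv_lhs => rw [h]
  rw [PowerSeries.subst_add hs, PowerSeries.subst_mul hs, PowerSeries.subst_X hs,
    PowerSeries.subst_C]
  have h2 : PowerSeries.constantCoeff (MvPowerSeries.C (PowerSeries.constantCoeff f) :
    PowerSeries S) = PowerSeries.constantCoeff f := MvPowerSeries.constantCoeff_C _
  rw [map_add, map_mul, ha, zero_mul, add_zero, h2]

theorem IsPUnitForm.subst_eq {S : Type*} [CommRing S] {q d : ℕ} (hq : (q : S) = 0)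
    {g : PowerSeries S} (h : IsPUnitForm q d g) :
    ∃ v : PowerSeries S, IsUnit v ∧ ∀ a : PowerSeries S, PowerSeries.HasSubst a →
      g.subst a = a ^ d * v.subst a := by
  obtain ⟨u, v, -, hv, rfl⟩ := h
  refine ⟨v, hv, fun a ha => ?_⟩
  rw [hq, map_zero, mul_zero, zero_mul, zero_add, PowerSeries.subst_mul ha,
    PowerSeries.subst_pow ha, PowerSeries.subst_X ha]

/-- If the reduction of `[p](x)` has order `d`, then `p` divides `d`. -/
theorem dvd_of_isPUnitForm {k : Type*} [CommRing k] [CharP k p] (q : R →+* k)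
    (F : FormalGroup R) {d : ℕ} (hd : 2 ≤ d)
    (h : IsPUnitForm p d (mulSeries F p)) : p ∣ d := by
  have := charZero_of_isCompleteLocalPRing p R
  let f : R →+* DualNumber k := (algebraMap k (DualNumber k)).comp q
  have hq : (p : DualNumber k) = 0 := by
    rw [← map_natCast (algebraMap k (DualNumber k)), CharP.cast_eq_zero, map_zero]
  obtain ⟨v, hv, hsub⟩ := (h.map f).subst_eq hq
  rw [← mulSeries_map] at hsub
  let G := F.map f
  let ε : DualNumber k := DualNumber.eps
  let P : G.Point Unit := coordPoint G
  have hQ0 : PowerSeries.constantCoeff (PowerSeries.C ε * PowerSeries.X) = 0 := by simp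
  let Q : G.Point Unit := ⟨PowerSeries.C ε * PowerSeries.X,
    PowerSeries.HasSubst.of_constantCoeff_zero' hQ0⟩
  have hP0 : PowerSeries.constantCoeff (R := DualNumber k) P.val = 0 := PowerSeries.constantCoeff_X
  -- Modulo `p` the series `[p]` is `x^d v` with `d ≥ 2`, so it kills the infinitesimal point `ε x`.
  have hpQ : p • Q = 0 := Subtype.ext <| by
    rw [nsmul_val]
    refine (hsub _ Q.prop).trans ?_
    obtain ⟨t, rfl⟩ : ∃ t, d = t + 2 := ⟨d - 2, by omega⟩
    have h2 : (PowerSeries.C ε * PowerSeries.X) ^ 2 = (0 : PowerSeries (DualNumber k)) := by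
      rw [mul_pow, ← map_pow, pow_two ε, DualNumber.eps_mul_eps, map_zero, zero_mul]
    change (PowerSeries.C ε * PowerSeries.X) ^ (t + 2) * _ = _
    rw [pow_add, h2, mul_zero, zero_mul]
    rfl
  have hadd := map_nsmul_add F f p P Q
  rw [hpQ, add_zero] at hadd
  have hval := congrArg Subtype.val hadd
  rw [nsmul_val, nsmul_val] at hval
  have hQ0 : PowerSeries.constantCoeff (R := DualNumber k) Q.val = 0 := hQ0
  have hA0 := constantCoeff_add_val G hP0 hQ0
  have hA1 := coeff_one_add_val G hP0 hQ0
  -- Now `[p]` agrees on `x` and on `x + ε x + ⋯`. Comparing coefficients of `x^d` gives `(1 + ε)^d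
  -- = 1`, that is `d = 0` in `k`.
  have h1 := (hsub _ (P + Q).prop).symm.trans (hval.trans (hsub _ P.prop))
  have hcoeff : ∀ a : PowerSeries (DualNumber k), PowerSeries.constantCoeff a = 0 →
      PowerSeries.coeff d (a ^ d * v.subst a)
        = PowerSeries.coeff 1 a ^ d * PowerSeries.constantCoeff v := fun a ha => by
    have hv := constantCoeff_subst_of_constantCoeff_eq_zero ha v
    obtain ⟨b, hb⟩ := PowerSeries.X_dvd_iff.mpr ha
    have h3 : PowerSeries.coeff 1 a = PowerSeries.constantCoeff b := by
      rw [hb, PowerSeries.coeff_succ_X_mul (n := 0),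
        PowerSeries.coeff_zero_eq_constantCoeff_apply]
    have h4 : a ^ d * v.subst a = PowerSeries.X ^ d * (b ^ d * v.subst a) := by
      conv_lhs => rw [show a ^ d = (PowerSeries.X * b) ^ d by rw [← hb]]
      ring
    rw [h4, PowerSeries.coeff_X_pow_mul', if_pos le_rfl, Nat.sub_self,
      PowerSeries.coeff_zero_eq_constantCoeff_apply, map_mul, map_pow, hv, h3]
  have h2 := (hcoeff _ hA0).symm.trans ((congrArg (PowerSeries.coeff d) h1).trans (hcoeff _ hP0))
  have hP1 : PowerSeries.coeff (R := DualNumber k) 1 P.val = 1 := PowerSeries.coeff_one_X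
  have hQ1 : PowerSeries.coeff (R := DualNumber k) 1 Q.val = ε := by
    change PowerSeries.coeff 1 (PowerSeries.C ε * PowerSeries.X) = ε
    rw [PowerSeries.coeff_C_mul, PowerSeries.coeff_one_X, mul_one]
  rw [hA1, hP1, hQ1, one_pow] at h2
  have h3 := ((PowerSeries.isUnit_iff_constantCoeff).mp hv).mul_right_cancel h2
  rw [one_add_eps_pow, add_eq_left] at h3
  have h4 := congrArg TrivSqZeroExt.snd h3
  rw [← CharP.cast_eq_zero_iff k p]
  have h5 : (d : DualNumber k) = TrivSqZeroExt.inl (d : k) := by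
    rw [TrivSqZeroExt.inl_natCast]
  rw [h5] at h4
  simpa [ε] using h4

omit hp [IsDomain R] [IsCompleteLocalPRing p R] in
theorem exists_not_dvd_coeff_mulSeries (F : FormalGroup R) (hF : height p F ≠ ⊤) :
    ∃ j, ¬ (p : R) ∣ PowerSeries.coeff j (mulSeries F p) := by
  by_contra! h
  apply hF
  rw [height, ENat.eq_top_iff_forall_ge]
  intro m
  refine le_iSup₂_of_le m (fun j _ => ?_) le_rfl
  rw [PowerSeries.coeff_map, Ideal.Quotient.eq_zero_iff_mem, Ideal.mem_span_singleton]
  exact h j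

omit hp [IsDomain R] [IsCompleteLocalPRing p R] in
theorem pow_two_dvd_of_two_le_height (F : FormalGroup R) (hF : 2 ≤ height p F) {d : ℕ}
    (hd : ¬ (p : R) ∣ PowerSeries.coeff d (mulSeries F p)) : p ^ 2 ∣ d := by
  have h1 : ((1 : ℕ) : ℕ∞) < height p F := lt_of_lt_of_le (by norm_num) hF
  rw [height, lt_iSup_iff] at h1
  obtain ⟨h, hh⟩ := h1
  rw [lt_iSup_iff] at hh
  obtain ⟨hc, hlt⟩ := hh
  have hlt : 1 < h := by exact_mod_cast hlt
  refine (pow_dvd_pow p hlt).trans ?_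
  by_contra hnd
  have := hc d hnd
  rw [PowerSeries.coeff_map, Ideal.Quotient.eq_zero_iff_mem, Ideal.mem_span_singleton] at this
  exact hd this

theorem exists_isPUnitForm_mulSeries (F : FormalGroup R) (hF : height p F ≠ ⊤)
    (hp2 : p ≠ 2 ∨ 2 ≤ height p F) :
    ∃ d r, d ≠ 0 ∧ 1 ≤ r ∧ p ^ r ∣ d ∧ (p ≠ 2 ∨ 2 ≤ r) ∧ IsPUnitForm p d (mulSeries F p) := by
  obtain ⟨d, hd, hnd, hform⟩ := exists_isPUnitForm (constantCoeff_mulSeries F p)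
    (coeff_one_mulSeries F p) (exists_not_dvd_coeff_mulSeries F hF)
  rcases hp2 with h2 | h2
  · exact ⟨d, 1, by omega, le_rfl, by
      have := charP_quotient_span_natCast p R
      simpa using dvd_of_isPUnitForm (Ideal.Quotient.mk (Ideal.span {(p : R)})) F hd hform, Or.inl h2, hform⟩
  · exact ⟨d, 2, by omega, by omega, pow_two_dvd_of_two_le_height F h2 hnd, Or.inr le_rfl, hform⟩

omit hp in
/-- The iterates of a series in unit form do not vanish modulo `p`. -/
theorem IsPUnitForm.substIterate_ne_zero {k : Type*} [CommRing k] [Nontrivial k] {d : ℕ}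
    (hd : d ≠ 0) (hq : (p : k) = 0) {g : PowerSeries k} (h : IsPUnitForm p d g) (ν : ℕ) :
    substIterate g ν ≠ 0 := by
  obtain ⟨v, hv, hsub⟩ := h.subst_eq hq
  -- Modulo `p` each application of `g = x^d v` raises to the `d`-th power up to a unit.
  have key : ∃ N u, N ≠ 0 ∧ IsUnit u ∧ substIterate g ν = PowerSeries.X ^ N * u := by
    induction ν with
    | zero => exact ⟨1, 1, one_ne_zero, isUnit_one, by simp [substIterate]⟩
    | succ ν ih =>
      obtain ⟨N, u, hN, hu, heq⟩ := ih
      have h0 := constantCoeff_substIterate (h.constantCoeff hd) ν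
      refine ⟨N * d, u ^ d * v.subst (substIterate g ν), Nat.mul_ne_zero hN hd,
        (hu.pow d).mul ?_, ?_⟩
      · rw [PowerSeries.isUnit_iff_constantCoeff,
          constantCoeff_subst_of_constantCoeff_eq_zero h0]
        exact PowerSeries.isUnit_iff_constantCoeff.mp hv
      · rw [substIterate, hsub _ (PowerSeries.HasSubst.of_constantCoeff_zero' h0)]
        conv_lhs => rw [show substIterate g ν ^ d = (PowerSeries.X ^ N * u) ^ d by rw [heq]]
        ring
  obtain ⟨N, u, -, hu, heq⟩ := key
  intro h0
  rw [heq] at h0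
  have h1 : (PowerSeries.X ^ N : PowerSeries k) = 0 := hu.mul_left_eq_zero.mp h0
  have h2 := congrArg (PowerSeries.coeff N) h1
  simp at h2

omit hp in
/-- The kernel of `[p^ν]` is cut out by a monic polynomial that reduces to a power of `x`. -/
theorem exists_distinguished_mem_kernelIdeal (F : FormalGroup R) {d : ℕ} (hd : d ≠ 0)
    (h : IsPUnitForm p d (mulSeries F p)) (ν : ℕ) :
    ∃ f ∈ kernelIdeal F (p ^ ν), 
      (∃ N, ∃ r : Polynomial R, f = Polynomial.X ^ N + Polynomial.C (p : R) * r) ∧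
      ∃ u, substIterate (mulSeries F p) ν = f * u := by
  have : IsAdicComplete (IsLocalRing.maximalIdeal R) R := by
    rw [IsCompleteLocalPRing.maximalIdeal_eq (p := p)]
    exact IsCompleteLocalPRing.isAdicComplete
  have hne : (substIterate (mulSeries F p) ν).map (IsLocalRing.residue R) ≠ 0 := by
    rw [map_substIterate _ (constantCoeff_mulSeries F p)]
    refine (h.map _).substIterate_ne_zero hd ?_ ν
    rw [← map_natCast (IsLocalRing.residue R), IsLocalRing.residue_eq_zero_iff]
    exact not_isUnit_natCast
  obtain ⟨f, u, hfu⟩ := PowerSeries.exists_isWeierstrassFactorization hne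
  obtain ⟨u', rfl⟩ := hfu.isUnit
  refine ⟨f, ?_, ⟨f.natDegree, ?_⟩, u', hfu.eq_mul⟩
  · rw [kernelIdeal, Ideal.mem_comap, Ideal.mem_span_singleton, mulSeries_pow, hfu.eq_mul]
    exact ⟨(↑u'⁻¹ : PowerSeries R), by simp [mul_assoc]⟩
  · have h1 := hfu.isDistinguishedAt.map_eq_X_pow
    have h2 : Polynomial.C (p : R) ∣ f - Polynomial.X ^ f.natDegree := by
      rw [Polynomial.C_dvd_iff_dvd_coeff]
      intro i
      rw [← Ideal.mem_span_singleton, ← IsCompleteLocalPRing.maximalIdeal_eq (p := p),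
        ← Ideal.Quotient.eq_zero_iff_mem, ← Polynomial.coeff_map, Polynomial.map_sub, h1]
      simp
    obtain ⟨r, hr⟩ := h2
    exact ⟨r, by rw [← hr]; ring⟩

end PUnitForm

/-! ### Equality of the prolongation ideal and the power ideal -/

section LimitIdeal

variable {p : ℕ} [hp : Fact p.Prime] {R : Type*} [CommRing R]

/-- The ideal `(p, δ^i f ; f ∈ I, i ≥ 0)` of `R{x}`. -/
def prolongationIdeal (φ : FrobeniusLift p R) (I : Ideal (Polynomial R)) : Ideal (DiffPoly R) :=
  Ideal.span ({(p : DiffPoly R)} ∪ {g | ∃ f ∈ I, ∃ i, g = (delta φ)^[i] (ofPoly f)})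

/-- The ideal `(p, x^q, (x')^q, …)` of `R{x}`. -/
def powerIdeal (p : ℕ) (R : Type*) [CommRing R] (q : ℕ) : Ideal (DiffPoly R) :=
  Ideal.span ({(p : DiffPoly R)} ∪ Set.range fun i : ℕ => (MvPolynomial.X i : DiffPoly R) ^ q)

variable [IsDomain R] [IsCompleteLocalPRing p R]

/-- Evaluation at the origin modulo `p` kills the ideal. Properness is what gives the quotient
characteristic `p`. -/
theorem powerIdeal_ne_top {q : ℕ} (hq : q ≠ 0) : powerIdeal p R q ≠ ⊤ := by
  let f : DiffPoly R →+* R ⧸ Ideal.span {(p : R)} :=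
    (Ideal.Quotient.mk _).comp (MvPolynomial.eval fun _ => 0)
  have hle : powerIdeal p R q ≤ RingHom.ker f := by
    refine Ideal.span_le.mpr (Set.union_subset ?_ ?_)
    · rintro _ rfl
      rw [SetLike.mem_coe, RingHom.mem_ker, map_natCast]
      have := charP_quotient_span_natCast p R
      exact CharP.cast_eq_zero _ p
    · rintro _ ⟨i, rfl⟩
      simp [f, RingHom.mem_ker, hq]
  intro h
  rw [h, top_le_iff] at hle
  have h1 : f 1 = 0 := by rw [← RingHom.mem_ker, hle]; trivial
  rw [map_one] at h1
  have := charP_quotient_span_natCast p R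
  exact hp.out.one_lt.ne' (Nat.dvd_one.mp
    ((CharP.cast_eq_zero_iff (R ⧸ Ideal.span {(p : R)}) p 1).mp (by rw [Nat.cast_one, h1])))

variable (φ : FrobeniusLift p R) (J : Ideal (DiffPoly R))

/-- The universal Witt vector `R{x} → W(R{x}/J)`. -/
def wittPoint : DiffPoly R →+* WittVector p (DiffPoly R ⧸ J) :=
  (WittVector.map (Ideal.Quotient.mk J)).comp
    (wittLift (natCast_diffPoly_ne_zero (p := p) (R := R)) (p_mul_delta φ))

theorem wittPoint_coeff (G : DiffPoly R) (n : ℕ) :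
    (wittPoint φ J G).coeff n = Ideal.Quotient.mk J (wittComponent p (delta φ) G n) := rfl

theorem wittPoint_eq_zero_iff (G : DiffPoly R) :
    wittPoint φ J G = 0 ↔ ∀ n, wittComponent p (delta φ) G n ∈ J := by
  simp only [WittVector.ext_iff, wittPoint_coeff, zero_coeff, Ideal.Quotient.eq_zero_iff_mem]

/-- The structure map `R → W(R{x}/J)`. -/
def wittScalar : R →+* WittVector p (DiffPoly R ⧸ J) := (wittPoint φ J).comp MvPolynomial.C

theorem wittPoint_ofPoly (f : Polynomial R) :
    wittPoint φ J (ofPoly f)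
      = (f.map (wittScalar φ J)).eval (wittPoint φ J (MvPolynomial.X 0)) := by
  rw [ofPoly, Polynomial.aeval_def, Polynomial.hom_eval₂, Polynomial.eval_map]
  rfl

theorem iterate_frobenius_wittPoint_eq_zero_iff [CharP (DiffPoly R ⧸ J) p]
    (hpJ : (p : DiffPoly R) ∈ J) (ν : ℕ) :
    frobenius^[ν] (wittPoint φ J (MvPolynomial.X 0)) = 0
      ↔ ∀ i, (MvPolynomial.X i : DiffPoly R) ^ p ^ ν ∈ J := by
  have h := pow_wittComponent_mem_iff natCast_diffPoly_ne_zero (p_mul_delta φ) hpJ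
    (MvPolynomial.X 0) ν
  simp only [delta_iterate_X] at h
  rw [← h]
  simp only [WittVector.ext_iff, iterate_frobenius_coeff, wittPoint_coeff, zero_coeff, ← map_pow,
    Ideal.Quotient.eq_zero_iff_mem]

omit [IsDomain R] [IsCompleteLocalPRing p R] in
theorem charP_quotient_of_natCast_mem {J : Ideal (DiffPoly R)} (hJ : J ≠ ⊤)
    (hpJ : (p : DiffPoly R) ∈ J) : CharP (DiffPoly R ⧸ J) p := by
  have := Ideal.Quotient.nontrivial_iff.mpr hJ
  refine charP_of_natCast_eq_zero hp.out ?_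
  rw [← map_natCast (Ideal.Quotient.mk J), Ideal.Quotient.eq_zero_iff_mem]
  exact hpJ

omit hp [IsDomain R] [IsCompleteLocalPRing p R] in
theorem natCast_mem_powerIdeal (q : ℕ) : (p : DiffPoly R) ∈ powerIdeal p R q :=
  Ideal.subset_span (Or.inl rfl)

omit [IsDomain R] [IsCompleteLocalPRing p R] in
theorem natCast_mem_prolongationIdeal (I : Ideal (Polynomial R)) :
    (p : DiffPoly R) ∈ prolongationIdeal φ I :=
  Ideal.subset_span (Or.inl rfl)

variable (F : FormalGroup R) {d r ν : ℕ}

/-- Modulo the power ideal `F^ν w = 0`, so `[p^ν]` vanishes at `w`, and so does every polynomial `f`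
that it divides. The vanishing of the Witt vector of `f` puts all `δ^i f` in the ideal. -/
theorem prolongationIdeal_le_powerIdeal (hd : d ≠ 0) (hpd : p ∣ d)
    (hform : IsPUnitForm p d (mulSeries F p)) :
    prolongationIdeal φ (kernelIdeal F (p ^ ν)) ≤ powerIdeal p R (p ^ ν) := by
  refine Ideal.span_le.mpr (Set.union_subset ?_ ?_)
  · rintro _ rfl
    exact natCast_mem_powerIdeal _
  rintro _ ⟨f, hf, i, rfl⟩
  have hpJ := natCast_mem_powerIdeal (p := p) (R := R) (p ^ ν)
  set J := powerIdeal p R (p ^ ν) with hJ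
  have := charP_quotient_of_natCast_mem
    (powerIdeal_ne_top (p := p) (R := R) (pow_ne_zero ν hp.out.ne_zero)) hpJ
  have hw : frobenius^[ν] (wittPoint φ J (MvPolynomial.X 0)) = 0 :=
    (iterate_frobenius_wittPoint_eq_zero_iff φ J hpJ ν).mpr
      fun i => Ideal.subset_span (Or.inr ⟨i, rfl⟩)
  have h0 := nilpEval_substIterate_eq_zero hd hpd (hform.map (wittScalar φ J)) hw
  have hf0 : wittPoint φ J (ofPoly f) = 0 := by
    rw [wittPoint_ofPoly, ← nilpEval_coe (isNilpotent_of_iterate_frobenius_eq_zero hw)]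
    rw [kernelIdeal, Ideal.mem_comap, Ideal.mem_span_singleton] at hf
    obtain ⟨c, hc⟩ := hf
    have hc : (f : PowerSeries R) = mulSeries F (p ^ ν) * c := hc
    rw [Polynomial.polynomial_map_coe, hc, map_mul, map_mul, mulSeries_pow,
      map_substIterate _ (constantCoeff_mulSeries F p), h0, zero_mul]
  exact iterate_mem_of_wittComponent_mem natCast_diffPoly_ne_zero (p_mul_delta φ)
    ((wittPoint_eq_zero_iff φ J _).mp hf0) i

/-- The distinguished polynomial of `[p^ν]` vanishes at `w`. Modulo `p` it is a power of `x`, so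
`w₀` is nilpotent and `[p^ν]` can be evaluated modulo each `V^n`, where it vanishes; hence `F^ν w =
0`. -/
theorem powerIdeal_le_prolongationIdeal (hd : d ≠ 0) (hr : 1 ≤ r) (hrd : p ^ r ∣ d)
    (hpr : p ≠ 2 ∨ 2 ≤ r) (hform : IsPUnitForm p d (mulSeries F p)) :
    powerIdeal p R (p ^ ν) ≤ prolongationIdeal φ (kernelIdeal F (p ^ ν)) := by
  have hpd : p ∣ d := (dvd_pow_self p (by omega)).trans hrd
  have hpJ := natCast_mem_prolongationIdeal φ (kernelIdeal F (p ^ ν))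
  have hne : prolongationIdeal φ (kernelIdeal F (p ^ ν)) ≠ ⊤ :=
    ne_top_of_le_ne_top (powerIdeal_ne_top (p := p) (R := R) (pow_ne_zero ν hp.out.ne_zero))
      (prolongationIdeal_le_powerIdeal φ F hd hpd hform)
  have hmem : ∀ f ∈ kernelIdeal F (p ^ ν), ∀ i,
      (delta φ)^[i] (ofPoly f) ∈ prolongationIdeal φ (kernelIdeal F (p ^ ν)) :=
    fun f hf i => Ideal.subset_span (Or.inr ⟨f, hf, i, rfl⟩)
  generalize prolongationIdeal φ (kernelIdeal F (p ^ ν)) = J at *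
  have := charP_quotient_of_natCast_mem hne hpJ
  obtain ⟨f, hf, ⟨N, t, hft⟩, u, hfu⟩ := exists_distinguished_mem_kernelIdeal F hd hform ν
  have hf0 : wittPoint φ J (ofPoly f) = 0 := (wittPoint_eq_zero_iff φ J _).mpr
    (wittComponent_mem_of_iterate_mem natCast_diffPoly_ne_zero (p_mul_delta φ) (hmem f hf))
  have hw : IsNilpotent ((wittPoint φ J (MvPolynomial.X 0)).coeff 0) := by
    refine ⟨N, ?_⟩
    rw [wittPoint_coeff, wittComponent_zero, ← map_pow, Ideal.Quotient.eq_zero_iff_mem]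
    have h1 := hmem f hf 0
    rw [Function.iterate_zero, id, hft, map_add, map_mul, map_pow] at h1
    have h2 : ofPoly (Polynomial.X : Polynomial R) = MvPolynomial.X 0 := Polynomial.aeval_X _
    have h3 : ofPoly (Polynomial.C (p : R)) = (p : DiffPoly R) := by
      rw [map_natCast, map_natCast]
    rw [h2, h3] at h1
    have h4 := sub_mem h1 (Ideal.mul_mem_right (ofPoly t) _ hpJ)
    rwa [add_sub_cancel_right] at h4
  have hF : frobenius^[ν] (wittPoint φ J (MvPolynomial.X 0)) = 0 := by
    refine iterate_frobenius_eq_zero hd hr hrd hpr (hform.map (wittScalar φ J)) hw fun n => ?_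
    rw [← map_substIterate _ (constantCoeff_mulSeries F p), hfu, map_mul, map_mul, map_mul,
      ← Polynomial.polynomial_map_coe, ← Polynomial.polynomial_map_coe, nilpEval_coe,
      Polynomial.eval_map_apply, ← wittPoint_ofPoly, hf0, map_zero, zero_mul]
  refine Ideal.span_le.mpr (Set.union_subset ?_ ?_)
  · rintro _ rfl
    exact hpJ
  · rintro _ ⟨i, rfl⟩
    exact (iterate_frobenius_wittPoint_eq_zero_iff φ J hpJ ν).mp hF i

end LimitIdeal

/-! ### The direct limit as a quotient of `R{x}` -/

section Limit

variable {p : ℕ} {R : Type*} [CommRing R]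

section Reduction

variable {K : Type*} [CommRing K] (π : R →+* K)

/-- The reduction map `R{x} → K[x, x', …] / (x^q, (x')^q, …)` for a ring homomorphism `R → K`. -/
def powerReduction (q : ℕ) : DiffPoly R →+* MvPolynomial ℕ K ⧸
    Ideal.span (Set.range fun i : ℕ => (MvPolynomial.X i : MvPolynomial ℕ K) ^ q) :=
  (Ideal.Quotient.mk _).comp (MvPolynomial.map π)

theorem powerReduction_surjective {π : R →+* K} (hπ : Function.Surjective π) (q : ℕ) :
    Function.Surjective (powerReduction π q) :=
  Ideal.Quotient.mk_surjective.comp (MvPolynomial.map_surjective _ hπ)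

theorem ker_powerReduction {π : R →+* K} (hπ : Function.Surjective π)
    (hker : RingHom.ker π = Ideal.span {(p : R)}) (q : ℕ) :
    RingHom.ker (powerReduction π q) = powerIdeal p R q := by
  apply le_antisymm
  · intro G hG
    rw [RingHom.mem_ker, powerReduction, RingHom.comp_apply, Ideal.Quotient.eq_zero_iff_mem] at hG
    have hspan : Ideal.span (Set.range fun i : ℕ => (MvPolynomial.X i : MvPolynomial ℕ K) ^ q)
        = (Ideal.span (Set.range fun i : ℕ => (MvPolynomial.X i : DiffPoly R) ^ q)).map
          (MvPolynomial.map π) := by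
      rw [Ideal.map_span, ← Set.range_comp]
      congr 2
      ext1 i
      simp
    rw [hspan, Ideal.mem_map_iff_of_surjective _ (MvPolynomial.map_surjective _ hπ)] at hG
    obtain ⟨G', hG', heq⟩ := hG
    have h1 : G - G' ∈ RingHom.ker (MvPolynomial.map (σ := ℕ) π) := by
      rw [RingHom.mem_ker, map_sub, heq, sub_self]
    rw [MvPolynomial.ker_map, hker, Ideal.map_span, Set.image_singleton, map_natCast] at h1
    have h2 : G - G' ∈ powerIdeal p R q := Ideal.span_mono Set.subset_union_left h1
    have h3 : G' ∈ powerIdeal p R q := Ideal.span_mono Set.subset_union_right hG'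
    have h4 := add_mem h2 h3
    rwa [sub_add_cancel] at h4
  · refine Ideal.span_le.mpr (Set.union_subset ?_ ?_)
    · rintro _ rfl
      have hp0 : π p = 0 := by
        rw [← RingHom.mem_ker, hker]
        exact Ideal.mem_span_singleton_self _
      rw [SetLike.mem_coe, RingHom.mem_ker, powerReduction, RingHom.comp_apply,
        ← map_natCast MvPolynomial.C, MvPolynomial.map_C, hp0, map_zero, map_zero]
    · rintro _ ⟨i, rfl⟩
      rw [SetLike.mem_coe, RingHom.mem_ker, powerReduction, RingHom.comp_apply,
        Ideal.Quotient.eq_zero_iff_mem]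
      exact Ideal.subset_span ⟨i, by simp⟩

end Reduction

/-- The kernel of the map from the completion to `A/p` is generated by `p`, as the ideal `(p)` is
finitely generated. Hence polynomials represent all classes of the jet rings modulo `p`. -/
theorem exists_eq_toPCompletion_add {A : Type*} [CommRing A] (y : PCompletion p A) :
    ∃ (a : A) (z : PCompletion p A), y = toPCompletion p A a + p * z := by
  obtain ⟨a, ha⟩ := Ideal.Quotient.mk_surjective (AdicCompletion.evalOneₐ (Ideal.span {(p : A)}) y)
  have h : y - toPCompletion p A a ∈
      RingHom.ker (AdicCompletion.evalOneₐ (Ideal.span {(p : A)})).toRingHom := by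
    rw [RingHom.mem_ker, map_sub, sub_eq_zero]
    exact ha.symm
  rw [AdicCompletion.ker_evalOneₐ_eq_map _ ⟨{(p : A)}, by simp⟩, Ideal.map_span,
    Set.image_singleton, map_natCast, Ideal.mem_span_singleton] at h
  obtain ⟨z, hz⟩ := h
  exact ⟨a, z, by rw [← hz]; ring⟩

variable [hp : Fact p.Prime] (φ : FrobeniusLift p R) (I : Ideal (Polynomial R))

theorem jetClass_incl_surjective (n : ℕ) (x : JetRingModP φ I n) :
    ∃ G, jetClass φ I n (incl n G) = x := by
  obtain ⟨x, rfl⟩ := Ideal.Quotient.mk_surjective x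
  obtain ⟨x, rfl⟩ := Ideal.Quotient.mk_surjective x
  obtain ⟨G, z, rfl⟩ := exists_eq_toPCompletion_add x
  refine ⟨G, ?_⟩
  have h : (Ideal.Quotient.mk (Ideal.span {(p : JetRing φ I n)})) p = 0 :=
    Ideal.Quotient.eq_zero_iff_mem.mpr (Ideal.mem_span_singleton_self _)
  rw [map_add, map_mul, map_natCast, map_add, map_mul, h, zero_mul, add_zero, jetClass]
  simp only [RingHom.comp_apply, AlgHom.toRingHom_eq_coe, RingHom.coe_coe, truncate_incl]

theorem jetClass_natCast (n : ℕ) : jetClass φ I n p = 0 := by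
  rw [jetClass, RingHom.comp_apply, map_natCast, Ideal.Quotient.eq_zero_iff_mem]
  exact Ideal.mem_span_singleton_self _

theorem jetClass_delta_iterate {f : Polynomial R} (hf : f ∈ I) {i n : ℕ} (h : i ≤ n) :
    jetClass φ I n ((delta φ)^[i] (ofPoly f)) = 0 := by
  have hmem : toPCompletion p (JetPoly R n) (truncate n ((delta φ)^[i] (ofPoly f)))
      ∈ jetIdeal φ I n := Ideal.subset_span ⟨f, hf, i, h, rfl⟩
  rw [jetClass, RingHom.comp_apply, RingHom.comp_apply]
  exact (congrArg _ (Ideal.Quotient.eq_zero_iff_mem.mpr hmem)).trans (map_zero _)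

/-- The elements of `(p, δ^i f ; f ∈ I, i ≥ 0)` vanish on the jet spaces of large order. -/
theorem exists_jetClass_eq_zero {G : DiffPoly R} (hG : G ∈ prolongationIdeal φ I) :
    ∃ n, ∀ m, n ≤ m → jetClass φ I m G = 0 := by
  induction hG using Submodule.span_induction with
  | mem x hx =>
    rcases hx with rfl | ⟨f, hf, i, rfl⟩
    · exact ⟨0, fun m _ => jetClass_natCast φ I m⟩
    · exact ⟨i, fun m hm => jetClass_delta_iterate φ I hf hm⟩
  | zero => exact ⟨0, fun m _ => map_zero _⟩
  | add x y _ _ hx hy =>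
    obtain ⟨a, ha⟩ := hx
    obtain ⟨b, hb⟩ := hy
    exact ⟨max a b, fun m hm => by
      rw [map_add, ha m (le_of_max_le_left hm), hb m (le_of_max_le_right hm), add_zero]⟩
  | smul c x _ hx =>
    obtain ⟨a, ha⟩ := hx
    exact ⟨a, fun m hm => by rw [smul_eq_mul, map_mul, ha m hm, mul_zero]⟩

variable [IsDomain R] [IsCompleteLocalPRing p R]

theorem jetRingModPMap_jetClass {n m : ℕ} (h : n ≤ m) (G : JetPoly R n) :
    jetRingModPMap φ I n m h (jetClass φ I n (incl n G)) = jetClass φ I m (incl n G) := by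
  simp only [jetClass, RingHom.comp_apply, AlgHom.toRingHom_eq_coe, RingHom.coe_coe,
    truncate_incl, jetRingModPMap, jetRingMap, Ideal.quotientMap_mk, pCompletionMap_toPCompletion]
  rw [← incl_jetPolyMap h, truncate_incl]

theorem toLimit_jetClass {n m : ℕ} (h : n ≤ m) (G : JetPoly R n) :
    toLimit φ I n (jetClass φ I n (incl n G)) = toLimit φ I m (jetClass φ I m (incl n G)) := by
  rw [← jetRingModPMap_jetClass φ I h]
  exact (Ring.DirectLimit.of_f ..).symm

section LevelMap

variable {T : Type*} [CommRing T] (θ : DiffPoly R →+* T)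
  (hθ : prolongationIdeal φ I ≤ RingHom.ker θ)

include hθ

omit [IsDomain R] [IsCompleteLocalPRing p R] in
theorem map_natCast_eq_zero : (p : T) = 0 := by
  rw [← map_natCast θ]
  exact hθ (natCast_mem_prolongationIdeal φ I)

/-- The map of the `p`-adic completion of `R[x, …, x^{(n)}]` induced by a map from `R{x}` that
kills `p`. -/
def completionLift (n : ℕ) : PCompletion p (JetPoly R n) →+* T :=
  (Ideal.Quotient.lift (Ideal.span {(p : JetPoly R n)}) (θ.comp (incl (R := R) n).toRingHom)
    fun a ha => by
      obtain ⟨b, rfl⟩ := Ideal.mem_span_singleton.mp ha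
      rw [map_mul, map_natCast, map_natCast_eq_zero φ I θ hθ, zero_mul]).comp
  (AdicCompletion.evalOneₐ (Ideal.span {(p : JetPoly R n)})).toRingHom

omit [IsDomain R] [IsCompleteLocalPRing p R] in
theorem completionLift_toPCompletion (n : ℕ) (G : JetPoly R n) :
    completionLift φ I θ hθ n (toPCompletion p _ G) = θ (incl n G) := rfl

/-- The map `𝒪ⁿ(X)/p → T` induced by a map `R{x} → T` that kills `p` and all `δ^i f`. -/
def levelMap (n : ℕ) : JetRingModP φ I n →+* T :=
  Ideal.Quotient.lift _ (Ideal.Quotient.lift (jetIdeal φ I n) (completionLift φ I θ hθ n)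
    fun a ha => by
      refine (Ideal.span_le (I := RingHom.ker (completionLift φ I θ hθ n))).mpr ?_ ha
      rintro _ ⟨f, hf, i, hi, rfl⟩
      rw [SetLike.mem_coe, RingHom.mem_ker, completionLift_toPCompletion,
        rename_truncate_delta_iterate φ f hi]
      exact hθ (Ideal.subset_span (Or.inr ⟨f, hf, i, rfl⟩)))
    fun a ha => by
      obtain ⟨b, rfl⟩ := Ideal.mem_span_singleton.mp ha
      rw [map_mul, map_natCast, map_natCast_eq_zero φ I θ hθ, zero_mul]

theorem levelMap_jetClass (n : ℕ) (G : JetPoly R n) :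
    levelMap φ I θ hθ n (jetClass φ I n (incl n G)) = θ (incl n G) := by
  simp only [jetClass, RingHom.comp_apply, AlgHom.toRingHom_eq_coe, RingHom.coe_coe,
    truncate_incl]
  rfl

theorem levelMap_jetRingModPMap (n m : ℕ) (h : n ≤ m) (x : JetRingModP φ I n) :
    levelMap φ I θ hθ m (jetRingModPMap φ I n m h x) = levelMap φ I θ hθ n x := by
  obtain ⟨G, rfl⟩ := jetClass_incl_surjective φ I n x
  rw [jetRingModPMap_jetClass, ← incl_jetPolyMap h, levelMap_jetClass, incl_jetPolyMap,
    levelMap_jetClass]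

/-- The map `lim 𝒪ⁿ(X)/p → T` induced by a map `R{x} → T` that kills `p` and all `δ^i f`. -/
def limitMap : LimitJetRingModP φ I →+* T :=
  Ring.DirectLimit.lift _ _ _ (levelMap φ I θ hθ) (levelMap_jetRingModPMap φ I θ hθ)

theorem limitMap_toLimit_jetClass (n : ℕ) (G : JetPoly R n) :
    limitMap φ I θ hθ (toLimit φ I n (jetClass φ I n (incl n G))) = θ (incl n G) := by
  rw [limitMap, toLimit, Ring.DirectLimit.lift_of, levelMap_jetClass]

/-- An element of the limit comes from a polynomial `G` at a finite level. If `θ` kills `G`, then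
`G` is a combination of `p` and finitely many `δ^i f`, all of which vanish at a large enough level.
-/
theorem limitMap_injective (hker : RingHom.ker θ ≤ prolongationIdeal φ I) :
    Function.Injective (limitMap φ I θ hθ) := by
  rw [injective_iff_map_eq_zero]
  intro z hz
  obtain ⟨n, x, rfl⟩ := Ring.DirectLimit.exists_of z
  obtain ⟨G, rfl⟩ := jetClass_incl_surjective φ I n x
  have h : θ (incl n G) = 0 := (limitMap_toLimit_jetClass φ I θ hθ n G).symm.trans hz
  obtain ⟨m, hm⟩ := exists_jetClass_eq_zero φ I (hker h)
  refine (toLimit_jetClass φ I (le_max_left n m) G).trans ?_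
  rw [hm _ (le_max_right n m), map_zero]

theorem limitMap_C (n : ℕ) (c : R) :
    limitMap φ I θ hθ (toLimit φ I n (jetClass φ I n (MvPolynomial.C c)))
      = θ (MvPolynomial.C c) := by
  have h : incl n (MvPolynomial.C c : JetPoly R n) = MvPolynomial.C c := MvPolynomial.rename_C _ _
  rw [← h, limitMap_toLimit_jetClass]

theorem limitMap_X {i n : ℕ} (hi : i ≤ n) :
    limitMap φ I θ hθ (toLimit φ I n (jetClass φ I n (MvPolynomial.X i)))
      = θ (MvPolynomial.X i) := by
  have h : incl n (MvPolynomial.X ⟨i, Nat.lt_succ_of_le hi⟩ : JetPoly R n) = MvPolynomial.X i :=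
    MvPolynomial.rename_X _ _
  rw [← h, limitMap_toLimit_jetClass]

theorem limitMap_surjective (hsurj : Function.Surjective θ) :
    Function.Surjective (limitMap φ I θ hθ) := by
  intro t
  obtain ⟨G, rfl⟩ := hsurj t
  induction G using MvPolynomial.induction_on with
  | C c => exact ⟨_, limitMap_C φ I θ hθ 0 c⟩
  | add f g hf hg =>
    obtain ⟨a, ha⟩ := hf
    obtain ⟨b, hb⟩ := hg
    exact ⟨a + b, by rw [map_add, map_add, ha, hb]⟩
  | mul_X f i hf =>
    obtain ⟨a, ha⟩ := hf
    exact ⟨a * toLimit φ I i (jetClass φ I i (MvPolynomial.X i)), by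
      rw [map_mul, map_mul, ha, limitMap_X φ I θ hθ (le_refl i)]⟩

theorem exists_limit_ringEquiv (hker : RingHom.ker θ ≤ prolongationIdeal φ I)
    (hsurj : Function.Surjective θ) :
    ∃ e : LimitJetRingModP φ I ≃+* T,
      (∀ (n : ℕ) (c : R),
        e (toLimit φ I n (jetClass φ I n (MvPolynomial.C c))) = θ (MvPolynomial.C c)) ∧
      ∀ i n : ℕ, i ≤ n →
        e (toLimit φ I n (jetClass φ I n ((delta φ)^[i] (MvPolynomial.X 0)))) =
          θ (MvPolynomial.X i) :=
  ⟨RingEquiv.ofBijective (limitMap φ I θ hθ)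
    ⟨limitMap_injective φ I θ hθ hker, limitMap_surjective φ I θ hθ hsurj⟩,
    limitMap_C φ I θ hθ, fun i n hi => by
      rw [delta_iterate_X]; exact limitMap_X φ I θ hθ hi⟩

end LevelMap

theorem exists_limit_ringEquiv_powerReduction {K : Type*} [CommRing K] {π : R →+* K}
    (hπ : Function.Surjective π) (hker : RingHom.ker π = Ideal.span {(p : R)}) {q : ℕ}
    (hle : prolongationIdeal φ I ≤ powerIdeal p R q)
    (hge : powerIdeal p R q ≤ prolongationIdeal φ I) :
    ∃ e : LimitJetRingModP φ I ≃+* (MvPolynomial ℕ K ⧸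
        Ideal.span (Set.range fun i : ℕ => (MvPolynomial.X i : MvPolynomial ℕ K) ^ q)),
      (∀ (n : ℕ) (c : R), e (toLimit φ I n (jetClass φ I n (MvPolynomial.C c))) =
          Ideal.Quotient.mk _ (MvPolynomial.C (π c))) ∧
      ∀ i n : ℕ, i ≤ n →
        e (toLimit φ I n (jetClass φ I n ((delta φ)^[i] (MvPolynomial.X 0)))) =
          Ideal.Quotient.mk _ (MvPolynomial.X i) := by
  rw [← ker_powerReduction hπ hker] at hle hge
  obtain ⟨e, hC, hX⟩ := exists_limit_ringEquiv φ I (powerReduction π q) hle hge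
    (powerReduction_surjective hπ q)
  refine ⟨e, fun n c => (hC n c).trans ?_, fun i n hi => (hX i n hi).trans ?_⟩
  · rw [powerReduction, RingHom.comp_apply, MvPolynomial.map_C]
  · rw [powerReduction, RingHom.comp_apply, MvPolynomial.map_X]

end Limit

end ArithmeticJet

end

theorem mainTheorem11 (p : ℕ) [Fact p.Prime] {R : Type*} [CommRing R] [IsDomain R]
    [ArithmeticJet.IsCompleteLocalPRing p R] (φ : ArithmeticJet.FrobeniusLift p R)
    (F : FormalGroup R) (hF : ArithmeticJet.height p F ≠ ⊤)
    (hp : p ≠ 2 ∨ 2 ≤ ArithmeticJet.height p F) (ν : ℕ) :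
    ∃ e : ArithmeticJet.LimitJetRingModP φ (ArithmeticJet.kernelIdeal F (p ^ ν)) ≃+*
        (MvPolynomial ℕ (R ⧸ Ideal.span {(p : R)}) ⧸
          Ideal.span (Set.range fun i : ℕ =>
            (MvPolynomial.X i : MvPolynomial ℕ (R ⧸ Ideal.span {(p : R)})) ^ p ^ ν)),
      (∀ (n : ℕ) (c : R),
        e (ArithmeticJet.toLimit φ (ArithmeticJet.kernelIdeal F (p ^ ν)) n
            (ArithmeticJet.jetClass φ (ArithmeticJet.kernelIdeal F (p ^ ν)) n
              (MvPolynomial.C c))) =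
          Ideal.Quotient.mk _ (MvPolynomial.C (Ideal.Quotient.mk (Ideal.span {(p : R)}) c))) ∧
      ∀ i n : ℕ, i ≤ n →
        e (ArithmeticJet.toLimit φ (ArithmeticJet.kernelIdeal F (p ^ ν)) n
            (ArithmeticJet.jetClass φ (ArithmeticJet.kernelIdeal F (p ^ ν)) n
              ((ArithmeticJet.delta φ)^[i] (MvPolynomial.X 0)))) =
          Ideal.Quotient.mk _ (MvPolynomial.X i) := by
  obtain ⟨d, r, hd, hr, hrd, hpr, hform⟩ := ArithmeticJet.exists_isPUnitForm_mulSeries F hF hp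
  exact ArithmeticJet.exists_limit_ringEquiv_powerReduction φ _ Ideal.Quotient.mk_surjective
    Ideal.mk_ker
    (ArithmeticJet.prolongationIdeal_le_powerIdeal φ F hd
      ((dvd_pow_self p (by omega)).trans hrd) hform)
    (ArithmeticJet.powerIdeal_le_prolongationIdeal φ F hd hr hrd hpr hform)
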